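/- Let $U\subset\mathbb R^2$ be a nonempty connected open set with coordinates $(x,y)$, and let $f:U\to\mathbb R^3$ be a smooth $L$-isothermic immersion without parabolic points, with unit normal $n=\frac{f_x\times f_y}{\|f_x\times f_y\|}$, for which $(x,y)$ are conformal principal coordinates. That is, $\mathrm{III}=dn\cdot dn=e^{2u}(dx^2+dy^2)$ and $f_x\cdot n_y=0$; equivalently, the $(2,0)$-part with respect to $\mathrm{III}$ of $\mathrm{II}=-df\cdot dn$ is a real multiple of $dz^2$, $z=x+iy$. Let $\varepsilon_1,\varepsilon_2\in\{1,-1\}$ be the signs with $n_x=e^{u}t_2$, $n_y=e^{u}t_3$, where $t_2=\varepsilon_1\frac{f_x}{\|f_x\|}$, $t_3=\varepsilon_2\frac{f_y}{\|f_y\|}$, and put $h_1=\varepsilon_1\|f_x\|$, $h_2=\varepsilon_2\|f_y\|$, so that $f_x=h_1t_2$, $f_y=h_2t_3$. Transforming functions of $f$ on an open set $V\subset U$ are smooth functions $r,v^1,v^2,v^3,v^4:V\to\mathbb R$ with $-2v^1v^4+(v^2)^2+(v^3)^2=0$, $v^1+v^4>0$ and $v^4\neq0$ everywhere, such that for some constant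 $m\in\mathbb R\setminus\{0\}$ $$\begin{aligned} dv^1&=\tfrac{e^u-me^{-u}}{\sqrt2}v^2dx+\tfrac{e^u+me^{-u}}{\sqrt2}v^3dy,\\ dv^2&=-\tfrac{e^u}{\sqrt2}v^1dx-v^3(u_ydx-u_xdy)+\tfrac{e^u-me^{-u}}{\sqrt2}v^4dx,\\ dv^3&=-\tfrac{e^u}{\sqrt2}v^1dy+v^2(u_ydx-u_xdy)+\tfrac{e^u+me^{-u}}{\sqrt2}v^4dy,\\ dv^4&=-\tfrac{e^u}{\sqrt2}v^2dx-\tfrac{e^u}{\sqrt2}v^3dy, \end{aligned}$$ and $dr=v^2h_1dx+v^3h_2dy$. They are called regular if the sphere map $S=\bigl(f+\tfrac{r}{\sqrt2v^4}n,\,-\tfrac{r}{\sqrt2v^4}\bigr):V\to\mathbb R^3\times\mathbb R$ is an immersion. Let $\mathbb R^4_1=\mathbb R^3\times\mathbb R$ carry the Lorentz product $\langle(c,R),(c',R')\rangle=c\cdot c'-RR'$, the point $(c,R)$ standing for the oriented sphere with centre $c$ and signed radius $R$; it is in oriented contact with the contact element $(x,n)$ if $c=x-Rn$. A smooth map $\hat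 f:U\to\mathbb R^3$ is a Bianchi–Darboux transform of $f$ on $U$ if there are a smooth $\hat n:U\to S^2$ and a smooth space-like immersion $S:U\to\mathbb R^4_1$ such that: - $d\hat f\cdot\hat n=0$, $d\hat n\cdot d\hat n$ is positive definite, and $(\hat f,\hat n)$ is $L$-isothermic with respect to the same $dz^2$, i.e. $d\hat n\cdot d\hat n$ is conformal to $dx^2+dy^2$ and $\hat f_x\cdot\hat n_y=0$ ($\hat f$ itself may have singular points); - at each $p$, the sphere $S(p)$ is in oriented contact with both $(f,n)(p)$ and $(\hat f,\hat n)(p)$, and $n(p)\ne\hat n(p)$; - $S$ is a Darboux congruence: the correspondence between the two envelopes preserves curvature lines (at each point there are two independent curvature directions common to both) and is conformal for the third fundamental forms; - $S$ is nondegenerate: it does not belong to a fixed sphere complex, i.e. $S(U)$ lies in no affine hyperplane of $\mathbb R^4_1$. Then: 1. For any regular transforming functions $r,v^1,\dots,v^4$ of $f$ on $U$, $$\hat f=f+\frac{\sqrt2\,r}{v^1+v^4}\,n-\frac{r\,v^2}{v^4(v^1+v^4)}\,\varepsilon_1\frac{f_x}{\|f_x\|}-\frac{r\,v^3}{v^4(v^1+v^4)}\,\varepsilon_2\frac{f_y}{\|f_y\|}$$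 is a Bianchi–Darboux transform of $f$ on $U$. 2. Conversely, if $\hat f$ is a Bianchi–Darboux transform of $f$ on $U$, then on every simply connected open set $V\subset U$ (in particular near every point, and on $U$ itself if $U$ is simply connected) there are regular transforming functions of $f$ for which $\hat f$ is given on $V$ by the formula in 1. -/

import Mathlib

open scoped ContDiff

noncomputable section

namespace LIsothermic

/-- Euclidean three-space. -/
abbrev E3 : Type := EuclideanSpace ℝ (Fin 3)

/-- The coordinate plane, with coordinates `(x, y)`. -/
abbrev Plane : Type := ℝ × ℝ

/-- The cross product of `ℝ³`. -/
def cross (a b : E3) : E3 := WithLp.toLp 2 (crossProduct (WithLp.ofLp a) (WithLp.ofLp b))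

/-- Partial derivative with respect to `x`. -/
def ddx {W : Type*} [NormedAddCommGroup W] [NormedSpace ℝ W] (g : Plane → W) (p : Plane) : W :=
  fderiv ℝ g p (1, 0)

/-- Partial derivative with respect to `y`. -/
def ddy {W : Type*} [NormedAddCommGroup W] [NormedSpace ℝ W] (g : Plane → W) (p : Plane) : W :=
  fderiv ℝ g p (0, 1)

/-- The coordinate one-form `dx`. -/
def dX : Plane →L[ℝ] ℝ := ContinuousLinearMap.fst ℝ ℝ ℝ

/-- The coordinate one-form `dy`. -/
def dY : Plane →L[ℝ] ℝ := ContinuousLinearMap.snd ℝ ℝ ℝ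

/-! ### Surfaces, Legendre maps, `L`-isothermic surfaces -/

/-- The unit normal `(f_x × f_y) / ‖f_x × f_y‖`. -/
def unitNormal (f : Plane → E3) (p : Plane) : E3 :=
  ‖cross (ddx f p) (ddy f p)‖⁻¹ • cross (ddx f p) (ddy f p)

/-- The second fundamental form `II = - df · dn`. -/
def secondForm (f n : Plane → E3) (p X Y : Plane) : ℝ :=
  - inner ℝ (fderiv ℝ f p X) (fderiv ℝ n p Y)

/-- The third fundamental form `III = dn · dn`. -/
def thirdForm (n : Plane → E3) (p X Y : Plane) : ℝ :=
  inner ℝ (fderiv ℝ n p X) (fderiv ℝ n p Y)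

/-- The coefficient `H` of the `(2,0)`-part `II^{(2,0)} = H dz²` of the second fundamental form,
with respect to the coordinate `z = x + i y`. -/
def hopfCoeff (f n : Plane → E3) (p : Plane) : ℂ :=
  (((secondForm f n p (1, 0) (1, 0) - secondForm f n p (0, 1) (0, 1)) / 4 : ℝ) : ℂ)
    - ((secondForm f n p (1, 0) (0, 1) / 2 : ℝ) : ℂ) * Complex.I

/-- `(f, n) : U → ℝ³ × S²` is a smooth Legendre map (`df · n = 0`) whose third fundamental form is
positive definite and which is `L`-isothermic for the polarization `q = dz²`, `z = x + i y`:
`z` is a complex coordinate for the conformal class of `III`, i.e. `III = e^{2u} (dx² + dy²)`, and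
the Hopf differential `II^{(2,0)}` is a smooth real multiple of `dz²`.  Equivalently, `(x, y)` are
conformal principal coordinates.  The Euclidean projection `f` may have singular points. -/
structure IsLIsothermicLegendre (U : Set Plane) (f n : Plane → E3) : Prop where
  smooth_f : ContDiffOn ℝ ∞ f U
  smooth_n : ContDiffOn ℝ ∞ n U
  unit : ∀ p ∈ U, ‖n p‖ = 1
  legendre : ∀ p ∈ U, ∀ X : Plane, inner ℝ (fderiv ℝ f p X) (n p) = 0
  third_pos : ∀ p ∈ U, ∀ X : Plane, X ≠ 0 → 0 < thirdForm n p X X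
  third_conformal : ∀ p ∈ U, thirdForm n p (1, 0) (1, 0) = thirdForm n p (0, 1) (0, 1) ∧
    thirdForm n p (1, 0) (0, 1) = 0
  hopf_real : ∃ μ : Plane → ℝ, ContDiffOn ℝ ∞ μ U ∧ ∀ p ∈ U, hopfCoeff f n p = (μ p : ℂ)

/-- `f : U → ℝ³` is an `L`-isothermic immersion (without parabolic points), oriented by the normal
`(f_x × f_y) / ‖f_x × f_y‖`, for which `(x, y)` are conformal principal coordinates. -/
structure IsLIsothermicImmersion (U : Set Plane) (f : Plane → E3) : Prop where
  immersion : ∀ p ∈ U, Function.Injective (fderiv ℝ f p)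
  legendre : IsLIsothermicLegendre U f (unitNormal f)

/-! ### Sphere congruences in Minkowski space -/

/-- Minkowski 4-space `ℝ⁴₁`; the point `(c, R)` is the oriented sphere with centre `c` and signed
radius `R`. -/
abbrev Mink : Type := E3 × ℝ

/-- The Lorentz scalar product of `ℝ⁴₁`. -/
def lorentz (a b : Mink) : ℝ := inner ℝ a.1 b.1 - a.2 * b.2

/-- The null line `{(x - t n, t)}` of the contact element `(x, n)`: the oriented spheres in
oriented contact at `x` with normal `n`. -/
def contactLine (x n : E3) : Set Mink := {s | ∃ t : ℝ, s = (x - t • n, t)}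

/-- `S` is a smooth space-like immersion. -/
def IsSpacelikeImmersion (U : Set Plane) (S : Plane → Mink) : Prop :=
  ContDiffOn ℝ ∞ S U ∧
    ∀ p ∈ U, ∀ X : Plane, X ≠ 0 → 0 < lorentz (fderiv ℝ S p X) (fderiv ℝ S p X)

/-- `(f, n)` envelopes the congruence `S`. -/
def Envelopes (U : Set Plane) (S : Plane → Mink) (f n : Plane → E3) : Prop :=
  ∀ p ∈ U, S p ∈ contactLine (f p) (n p)

/-- `X` is a curvature direction of `(f, n)` at `p`. -/
def IsCurvatureDirection (f n : Plane → E3) (p X : Plane) : Prop :=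
  ∃ l : ℝ, fderiv ℝ f p X = l • fderiv ℝ n p X

/-- The correspondence of `(f, n)` and `(f', n')` preserves curvature lines: at every point there
are two independent directions which are curvature directions of both. -/
def PreservesCurvatureLines (U : Set Plane) (f n f' n' : Plane → E3) : Prop :=
  ∀ p ∈ U, ∃ X Y : Plane, LinearIndependent ℝ ![X, Y] ∧
    IsCurvatureDirection f n p X ∧ IsCurvatureDirection f' n' p X ∧
    IsCurvatureDirection f n p Y ∧ IsCurvatureDirection f' n' p Y

/-- The third fundamental forms of the two maps are conformal at corresponding points. -/
def ThirdFormsConformal (U : Set Plane) (n n' : Plane → E3) : Prop :=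
  ∀ p ∈ U, ∃ φ : ℝ, 0 < φ ∧ ∀ X Y : Plane, thirdForm n' p X Y = φ * thirdForm n p X Y

/-- All spheres of `S` belong to a fixed (linear) sphere complex, i.e. `S` lies in an affine
hyperplane of `ℝ⁴₁`. -/
def InFixedSphereComplex (U : Set Plane) (S : Plane → Mink) : Prop :=
  ∃ (C : Mink) (k : ℝ), C ≠ 0 ∧ ∀ p ∈ U, lorentz (S p) C = k

/-- `S` is a Darboux sphere congruence with the two envelopes `(f, n)` and `(f', n')`: a space-like
immersion such that the correspondence of its envelopes preserves curvature lines and is conformal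
for the third fundamental forms. -/
structure IsDarbouxCongruence (U : Set Plane) (S : Plane → Mink) (f n f' n' : Plane → E3) :
    Prop where
  spacelike : IsSpacelikeImmersion U S
  envelopes : Envelopes U S f n
  envelopes' : Envelopes U S f' n'
  distinct : ∀ p ∈ U, n p ≠ n' p
  ribaucour : PreservesCurvatureLines U f n f' n'
  conformal : ThirdFormsConformal U n n'

/-- `(f, n)` and `(f', n')` form a Bianchi-Darboux pair: they are the two `L`-isothermic envelopes
of a nondegenerate Darboux congruence, the degenerate Darboux congruences being those that belong
to a fixed sphere complex. -/
def IsBianchiDarbouxPair (U : Set Plane) (f n f' n' : Plane → E3) : Prop :=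
  IsLIsothermicLegendre U f n ∧ IsLIsothermicLegendre U f' n' ∧
    ∃ S : Plane → Mink, IsDarbouxCongruence U S f n f' n' ∧ ¬ InFixedSphereComplex U S

/-- `f'` is a Bianchi-Darboux transform of the immersion `f`. -/
def IsBianchiDarbouxTransform (U : Set Plane) (f f' : Plane → E3) : Prop :=
  ∃ n' : Plane → E3, IsBianchiDarbouxPair U f (unitNormal f) f' n'

/-! ### The linear system and the explicit transform -/

/-- The function `u` with `III = e^{2u} (dx² + dy²)`. -/
def confFactor (f : Plane → E3) (p : Plane) : ℝ := Real.log ‖ddx (unitNormal f) p‖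

/-- The sign `ε₁` with `n_x = ε₁ e^u f_x / ‖f_x‖`. -/
def sign₁ (f : Plane → E3) (p : Plane) : ℝ :=
  Real.sign (inner ℝ (ddx f p) (ddx (unitNormal f) p))

/-- The sign `ε₂` with `n_y = ε₂ e^u f_y / ‖f_y‖`. -/
def sign₂ (f : Plane → E3) (p : Plane) : ℝ :=
  Real.sign (inner ℝ (ddy f p) (ddy (unitNormal f) p))

/-- The frame vector `t₂ = ε₁ f_x / ‖f_x‖`; it satisfies `n_x = e^u t₂`. -/
def frame₂ (f : Plane → E3) (p : Plane) : E3 := (sign₁ f p * ‖ddx f p‖⁻¹) • ddx f p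

/-- The frame vector `t₃ = ε₂ f_y / ‖f_y‖`; it satisfies `n_y = e^u t₃`. -/
def frame₃ (f : Plane → E3) (p : Plane) : E3 := (sign₂ f p * ‖ddy f p‖⁻¹) • ddy f p

/-- The function `h₁` with `f_x = h₁ t₂`. -/
def h₁ (f : Plane → E3) (p : Plane) : ℝ := sign₁ f p * ‖ddx f p‖

/-- The function `h₂` with `f_y = h₂ t₃`. -/
def h₂ (f : Plane → E3) (p : Plane) : ℝ := sign₂ f p * ‖ddy f p‖

/-- `r, v¹, v², v³, v⁴` are transforming functions of `f` on `U`, with constant `m ≠ 0`: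
`v` is a solution of the linear system with values in the positive light cone
`-2 v¹ v⁴ + (v²)² + (v³)² = 0`, `v¹ + v⁴ > 0`, with `v⁴` nowhere zero, and `r` is a primitive of
`γ = v² h₁ dx + v³ h₂ dy`. -/
structure IsTransforming (U : Set Plane) (f : Plane → E3) (m : ℝ) (r v₁ v₂ v₃ v₄ : Plane → ℝ) :
    Prop where
  m_ne : m ≠ 0
  smooth_r : ContDiffOn ℝ ∞ r U
  smooth₁ : ContDiffOn ℝ ∞ v₁ U
  smooth₂ : ContDiffOn ℝ ∞ v₂ U
  smooth₃ : ContDiffOn ℝ ∞ v₃ U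
  smooth₄ : ContDiffOn ℝ ∞ v₄ U
  null : ∀ p ∈ U, -2 * v₁ p * v₄ p + v₂ p ^ 2 + v₃ p ^ 2 = 0
  pos : ∀ p ∈ U, 0 < v₁ p + v₄ p
  v₄_ne : ∀ p ∈ U, v₄ p ≠ 0
  eq₁ : ∀ p ∈ U, fderiv ℝ v₁ p =
    ((Real.exp (confFactor f p) - m * Real.exp (-confFactor f p)) / √2 * v₂ p) • dX
    + ((Real.exp (confFactor f p) + m * Real.exp (-confFactor f p)) / √2 * v₃ p) • dY
  eq₂ : ∀ p ∈ U, fderiv ℝ v₂ p =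
    -((Real.exp (confFactor f p) / √2 * v₁ p) • dX)
    - v₃ p • (ddy (confFactor f) p • dX - ddx (confFactor f) p • dY)
    + ((Real.exp (confFactor f p) - m * Real.exp (-confFactor f p)) / √2 * v₄ p) • dX
  eq₃ : ∀ p ∈ U, fderiv ℝ v₃ p =
    -((Real.exp (confFactor f p) / √2 * v₁ p) • dY)
    + v₂ p • (ddy (confFactor f) p • dX - ddx (confFactor f) p • dY)
    + ((Real.exp (confFactor f p) + m * Real.exp (-confFactor f p)) / √2 * v₄ p) • dY
  eq₄ : ∀ p ∈ U, fderiv ℝ v₄ p =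
    -((Real.exp (confFactor f p) / √2 * v₂ p) • dX)
    - (Real.exp (confFactor f p) / √2 * v₃ p) • dY
  eq_r : ∀ p ∈ U, fderiv ℝ r p = (v₂ p * h₁ f p) • dX + (v₃ p * h₂ f p) • dY

/-- The spheres tangent to `f` with centre `f + (r / (√2 v⁴)) n`. -/
def sphereMap (f : Plane → E3) (r v₄ : Plane → ℝ) (p : Plane) : Mink :=
  (f p + (r p / (√2 * v₄ p)) • unitNormal f p, -(r p / (√2 * v₄ p)))

/-- The sphere map of the transforming functions is an immersion on `U`. -/
def SphereMapImmersed (U : Set Plane) (f : Plane → E3) (r v₄ : Plane → ℝ) : Prop :=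
  ∀ p ∈ U, Function.Injective (fderiv ℝ (sphereMap f r v₄) p)

/-- The explicit transform of `f`. -/
def explicitTransform (f : Plane → E3) (r v₁ v₂ v₃ v₄ : Plane → ℝ) (p : Plane) : E3 :=
  f p + (√2 * r p / (v₁ p + v₄ p)) • unitNormal f p
    - (r p * v₂ p / (v₄ p * (v₁ p + v₄ p))) • frame₂ f p
    - (r p * v₃ p / (v₄ p * (v₁ p + v₄ p))) • frame₃ f p

end LIsothermic

end

open LIsothermic

/-! A second unit normal `N ≠ n` is written through stereographic coordinates: `N = n + D (-n + a t₂
+ b t₃)` with `D = 2 / (1 + a² + b²)`. Then `N` is the mirror image of `n`, and the same reflection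
carries `t₂, t₃` to `τ₂ = t₂ - a (N - n)` and `τ₃ = t₃ - b (N - n)`. A sphere of radius `ρ` tangent
to both contact elements forces `f' = f + ρ (N - n)`, so a transform is the same as a triple `(a, b,
ρ)`. With `a = v² / (√2 v⁴)`, `b = v³ / (√2 v⁴)`, `ρ = -r / (√2 v⁴)`, which is an affine chart of
the light cone, the linear system becomes a Riccati system for `a, b` and a linear equation for `ρ`.
Both directions of the theorem pass through `RiccatiSolution`.

Riccati to transform: the system says `N_x = -κ τ₂`, `N_y = κ τ₃` with `κ = m D / (2 e^u)`. As `τ₂,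
τ₃` are orthonormal and `f'_x, f'_y` are multiples of `N_x, N_y`, the second envelope is
`L`-isothermic in the same coordinates (`RiccatiSolution.isBianchiDarbouxPair`). Nondegeneracy comes
from `m ≠ 0`.

Transform to Riccati: contact determines `dρ`, and the common principal coordinates give `N_x = κ₁
τ₂`, `N_y = κ₂ τ₃` with `κ₁² = κ₂²`. By connectedness `κ₁ = κ₂` everywhere or `κ₁ = -κ₂` everywhere.
In the first case a suitable combination of the null directions `(n, -1)` and `(N, -1)` is a
constant vector orthogonal to `dS`, so `S` lies in a fixed sphere complex, which is excluded
(`ReflectedFrame.inFixedSphereComplex`). In the second case the Codazzi equations make `m = 2 κ₂ e^u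
/ D` constant, and `a, b` solve the Riccati system (`ReflectedFrame.exists_riccatiSolution`).

Returning to the linear system needs only the scale `v⁴`, which solves `d log v⁴ = -e^u (a dx + b
dy)`. This form is closed, and integrating it is the one place where simple connectedness is used.
-/

noncomputable section

namespace LIsothermic

open Filter Topology

/-! ### Calculus of partial derivatives -/

/-- `g` is differentiable at `p` with partial derivatives `a` and `b`. -/
def HasPartials {W : Type*} [NormedAddCommGroup W] [NormedSpace ℝ W] (g : Plane → W) (a b : W)
    (p : Plane) : Prop :=
  HasFDerivAt g (dX.smulRight a + dY.smulRight b) p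

section Partials

variable {W : Type*} [NormedAddCommGroup W] [NormedSpace ℝ W] {g g' : Plane → W} {a b a' b' : W}
  {p : Plane}

theorem clm_eq_smulRight (L : Plane →L[ℝ] W) :
    L = dX.smulRight (L (1, 0)) + dY.smulRight (L (0, 1)) := by
  ext <;> simp [dX, dY]

theorem hasPartials_of_hasFDerivAt {L : Plane →L[ℝ] W} (h : HasFDerivAt g L p)
    (ha : L (1, 0) = a) (hb : L (0, 1) = b) : HasPartials g a b p := by
  rw [HasPartials, ← ha, ← hb, ← clm_eq_smulRight]
  exact h

theorem hasPartials_of_differentiableAt (h : DifferentiableAt ℝ g p) :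
    HasPartials g (ddx g p) (ddy g p) p :=
  hasPartials_of_hasFDerivAt h.hasFDerivAt rfl rfl

namespace HasPartials

theorem fderiv_eq (h : HasPartials g a b p) :
    fderiv ℝ g p = dX.smulRight a + dY.smulRight b := HasFDerivAt.fderiv h

theorem fderiv_apply (h : HasPartials g a b p) (X : Plane) :
    fderiv ℝ g p X = X.1 • a + X.2 • b := by
  rw [h.fderiv_eq]; simp [dX, dY]

theorem ddx_eq (h : HasPartials g a b p) : ddx g p = a := by
  simp [ddx, h.fderiv_apply]

theorem ddy_eq (h : HasPartials g a b p) : ddy g p = b := by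
  simp [ddy, h.fderiv_apply]

theorem congr_partials (h : HasPartials g a b p) (ha : a = a') (hb : b = b') :
    HasPartials g a' b' p := ha ▸ hb ▸ h

theorem congr_of_eqOn {U : Set Plane} (h : HasPartials g a b p) (hU : IsOpen U) (hp : p ∈ U)
    (he : ∀ q ∈ U, g' q = g q) : HasPartials g' a b p :=
  HasFDerivAt.congr_of_eventuallyEq h (by filter_upwards [hU.mem_nhds hp] with q hq using he q hq)

theorem unique (h : HasPartials g a b p) (h' : HasPartials g a' b' p) : a = a' ∧ b = b' :=
  ⟨h.ddx_eq.symm.trans h'.ddx_eq, h.ddy_eq.symm.trans h'.ddy_eq⟩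

theorem const (c : W) : HasPartials (fun _ => c) 0 0 p :=
  hasPartials_of_hasFDerivAt (hasFDerivAt_const c p) rfl rfl

theorem add (h : HasPartials g a b p) (h' : HasPartials g' a' b' p) :
    HasPartials (fun q => g q + g' q) (a + a') (b + b') p :=
  hasPartials_of_hasFDerivAt (HasFDerivAt.add h h') (by simp [dX, dY]) (by simp [dX, dY])

theorem sub (h : HasPartials g a b p) (h' : HasPartials g' a' b' p) :
    HasPartials (fun q => g q - g' q) (a - a') (b - b') p :=
  hasPartials_of_hasFDerivAt (HasFDerivAt.sub h h') (by simp [dX, dY]) (by simp [dX, dY])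

theorem neg (h : HasPartials g a b p) : HasPartials (fun q => -g q) (-a) (-b) p :=
  hasPartials_of_hasFDerivAt (HasFDerivAt.neg h) (by simp [dX, dY]) (by simp [dX, dY])

theorem smul {s : Plane → ℝ} {s₁ s₂ : ℝ} (hs : HasPartials s s₁ s₂ p) (h : HasPartials g a b p) :
    HasPartials (fun q => s q • g q) (s₁ • g p + s p • a) (s₂ • g p + s p • b) p :=
  hasPartials_of_hasFDerivAt (HasFDerivAt.smul hs h) (by simp [dX, dY, add_comm])
    (by simp [dX, dY, add_comm])

theorem prodMk {W' : Type*} [NormedAddCommGroup W'] [NormedSpace ℝ W'] {k : Plane → W'} {c d : W'}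
    (h : HasPartials g a b p) (h' : HasPartials k c d p) :
    HasPartials (fun q => (g q, k q)) (a, c) (b, d) p :=
  hasPartials_of_hasFDerivAt (HasFDerivAt.prodMk h h') (by simp [dX, dY]) (by simp [dX, dY])

theorem inner {a₁ a₂ b₁ b₂ : E3} {k l : Plane → E3} (h : HasPartials k a₁ a₂ p)
    (h' : HasPartials l b₁ b₂ p) :
    HasPartials (fun q => inner ℝ (k q) (l q)) (inner ℝ a₁ (l p) + inner ℝ (k p) b₁)
      (inner ℝ a₂ (l p) + inner ℝ (k p) b₂) p :=
  hasPartials_of_hasFDerivAt (HasFDerivAt.inner ℝ h h') (by simp [dX, dY, add_comm])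
    (by simp [dX, dY, add_comm])

variable {s t : Plane → ℝ} {s₁ s₂ t₁ t₂ : ℝ}

theorem mul (h : HasPartials s s₁ s₂ p) (h' : HasPartials t t₁ t₂ p) :
    HasPartials (fun q => s q * t q) (s₁ * t p + s p * t₁) (s₂ * t p + s p * t₂) p := h.smul h'

theorem comp {k : ℝ → ℝ} {k' : ℝ} (hk : HasDerivAt k k' (s p)) (h : HasPartials s s₁ s₂ p) :
    HasPartials (fun q => k (s q)) (k' * s₁) (k' * s₂) p :=
  hasPartials_of_hasFDerivAt (hk.comp_hasFDerivAt p h) (by simp [dX, dY])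
    (by simp [dX, dY])

theorem inv (h : HasPartials s s₁ s₂ p) (hs : s p ≠ 0) :
    HasPartials (fun q => (s q)⁻¹) (-(s p ^ 2)⁻¹ * s₁) (-(s p ^ 2)⁻¹ * s₂) p :=
  comp (hasDerivAt_inv hs) h

theorem div (h : HasPartials s s₁ s₂ p) (h' : HasPartials t t₁ t₂ p) (ht : t p ≠ 0) :
    HasPartials (fun q => s q / t q) ((s₁ * t p - s p * t₁) / t p ^ 2)
      ((s₂ * t p - s p * t₂) / t p ^ 2) p := by
  simp only [div_eq_mul_inv (s _)]
  exact (h.mul (h'.inv ht)).congr_partials (by field_simp; ring) (by field_simp; ring)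

theorem exp (h : HasPartials s s₁ s₂ p) :
    HasPartials (fun q => Real.exp (s q)) (Real.exp (s p) * s₁) (Real.exp (s p) * s₂) p :=
  comp (Real.hasDerivAt_exp _) h

theorem log (h : HasPartials s s₁ s₂ p) (hs : s p ≠ 0) :
    HasPartials (fun q => Real.log (s q)) ((s p)⁻¹ * s₁) ((s p)⁻¹ * s₂) p :=
  comp (Real.hasDerivAt_log hs) h

/-- Equality of the mixed second partial derivatives. -/
theorem symm {U : Set Plane} (hU : IsOpen U) (hp : p ∈ U) {k l : Plane → W}
    (h : ∀ q ∈ U, HasPartials g (k q) (l q) q) (hk : HasPartials k a a' p)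
    (hl : HasPartials l b b' p) : a' = b := by
  let F : W →L[ℝ] Plane →L[ℝ] W := ContinuousLinearMap.smulRightL ℝ Plane W dX
  let G : W →L[ℝ] Plane →L[ℝ] W := ContinuousLinearMap.smulRightL ℝ Plane W dY
  have hd : HasFDerivAt (fun q => dX.smulRight (k q) + dY.smulRight (l q))
      (F.comp (dX.smulRight a + dY.smulRight a') + G.comp (dX.smulRight b + dY.smulRight b')) p :=
    HasFDerivAt.add (F.hasFDerivAt.comp p hk) (G.hasFDerivAt.comp p hl)
  have := second_derivative_symmetric_of_eventually (f := g)
    (by filter_upwards [hU.mem_nhds hp] with q hq using h q hq) hd (0, 1) (1, 0)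
  simpa [F, G, dX, dY] using this

end HasPartials

theorem eq_of_hasPartials_zero {U : Set Plane} (hU : IsOpen U) (hUc : IsPreconnected U)
    (h : ∀ q ∈ U, HasPartials g 0 0 q) {p q : Plane} (hp : p ∈ U) (hq : q ∈ U) : g p = g q := by
  refine hU.is_const_of_fderiv_eq_zero hUc
    (fun x hx => (HasFDerivAt.differentiableAt (h x hx)).differentiableWithinAt) (fun x hx => ?_)
    hp hq
  rw [(h x hx).fderiv_eq]; ext <;> simp

theorem contDiffOn_ddx {U : Set Plane} (hU : IsOpen U) (hg : ContDiffOn ℝ ∞ g U) :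
    ContDiffOn ℝ ∞ (ddx g) U :=
  (hg.fderiv_of_isOpen hU (m := ∞) (by simp)).clm_apply contDiffOn_const

theorem contDiffOn_ddy {U : Set Plane} (hU : IsOpen U) (hg : ContDiffOn ℝ ∞ g U) :
    ContDiffOn ℝ ∞ (ddy g) U :=
  (hg.fderiv_of_isOpen hU (m := ∞) (by simp)).clm_apply contDiffOn_const

theorem hasPartials_of_contDiffOn {U : Set Plane} (hU : IsOpen U) (hg : ContDiffOn ℝ ∞ g U)
    (hp : p ∈ U) : HasPartials g (ddx g p) (ddy g p) p :=
  hasPartials_of_differentiableAt ((hg.contDiffAt (hU.mem_nhds hp)).differentiableAt (by simp))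

/-- The product rule for a scalar product that is constant on an open set. -/
theorem HasPartials.inner_const {U : Set Plane} (hU : IsOpen U) (hp : p ∈ U) {k l : Plane → E3}
    {a₁ a₂ b₁ b₂ : E3} {c : ℝ} (h : HasPartials k a₁ a₂ p) (h' : HasPartials l b₁ b₂ p)
    (hc : ∀ q ∈ U, Inner.inner ℝ (k q) (l q) = c) :
    Inner.inner ℝ a₁ (l p) + Inner.inner ℝ (k p) b₁ = 0 ∧
      Inner.inner ℝ a₂ (l p) + Inner.inner ℝ (k p) b₂ = 0 :=
  (h.inner h').unique ((HasPartials.const c).congr_of_eqOn hU hp hc)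

end Partials

/-! ### Orthonormal frames of `ℝ³` -/

section Orthonormal

variable {e₁ e₂ e₃ : E3}

/-- Used to verify vector identities in ℝ³ by comparing components along an orthonormal frame. -/
theorem eq_of_inner_eq (h₁ : inner ℝ e₁ e₁ = (1 : ℝ)) (h₂ : inner ℝ e₂ e₂ = (1 : ℝ))
    (h₃ : inner ℝ e₃ e₃ = (1 : ℝ)) (h₁₂ : inner ℝ e₁ e₂ = (0 : ℝ)) (h₁₃ : inner ℝ e₁ e₃ = (0 : ℝ))
    (h₂₃ : inner ℝ e₂ e₃ = (0 : ℝ)) {v w : E3} (k₁ : inner ℝ v e₁ = inner ℝ w e₁)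
    (k₂ : inner ℝ v e₂ = inner ℝ w e₂) (k₃ : inner ℝ v e₃ = inner ℝ w e₃) : v = w := by
  have h₂₁ : inner ℝ e₂ e₁ = (0 : ℝ) := by rw [real_inner_comm, h₁₂]
  have h₃₁ : inner ℝ e₃ e₁ = (0 : ℝ) := by rw [real_inner_comm, h₁₃]
  have h₃₂ : inner ℝ e₃ e₂ = (0 : ℝ) := by rw [real_inner_comm, h₂₃]
  have ho : Orthonormal ℝ ![e₁, e₂, e₃] := by
    rw [orthonormal_iff_ite]
    intro i j
    fin_cases i <;> fin_cases j <;> first | exact h₁ | exact h₂ | exact h₃ | simpa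
  let B := OrthonormalBasis.mk ho (ho.linearIndependent.span_eq_top_of_card_eq_finrank' (by simp)).ge
  refine InnerProductSpace.ext_inner_right_basis B.toBasis fun i => ?_
  fin_cases i <;> simp [B, k₁, k₂, k₃]

theorem eq_of_inner_eq_of_orthogonal (h₁ : inner ℝ e₁ e₁ ≠ (0 : ℝ)) (h₂ : inner ℝ e₂ e₂ ≠ (0 : ℝ))
    (h₃ : inner ℝ e₃ e₃ ≠ (0 : ℝ)) (h₁₂ : inner ℝ e₁ e₂ = (0 : ℝ)) (h₁₃ : inner ℝ e₁ e₃ = (0 : ℝ))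
    (h₂₃ : inner ℝ e₂ e₃ = (0 : ℝ)) {v w : E3} (k₁ : inner ℝ v e₁ = inner ℝ w e₁)
    (k₂ : inner ℝ v e₂ = inner ℝ w e₂) (k₃ : inner ℝ v e₃ = inner ℝ w e₃) : v = w := by
  have key {e : E3} (h : inner ℝ e e ≠ (0 : ℝ)) :
      inner ℝ (‖e‖⁻¹ • e) (‖e‖⁻¹ • e) = (1 : ℝ) := by
    have : ‖e‖ ≠ 0 := by simpa using h
    rw [real_inner_smul_left, real_inner_smul_right, real_inner_self_eq_norm_sq]
    field_simp
  apply eq_of_inner_eq (key h₁) (key h₂) (key h₃) <;>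
    simp [real_inner_smul_left, real_inner_smul_right, *]

end Orthonormal

/-! ### Closed one-forms on simply connected open sets -/

/-- The real numbers with the discrete topology. -/
@[ext]
structure DiscreteReal where
  /-- The underlying real number. -/
  val : ℝ

/-- A bundle with discrete fibre is a covering map, so its sections can be obtained by lifting; the
additive constants of local primitives must therefore carry this topology. -/
instance : TopologicalSpace DiscreteReal := ⊥

instance : DiscreteTopology DiscreteReal := ⟨rfl⟩

/-- On a simply connected open set, a one-form with local primitives has a primitive. -/
theorem exists_primitive_of_local {M : Type*} [NormedAddCommGroup M] [NormedSpace ℝ M]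
    {V : Set M} (hV : IsOpen V) (hVs : IsSimplyConnected V) {θ : M → M →L[ℝ] ℝ}
    (hθ : ∀ x ∈ V, ∃ ε > 0, Metric.ball x ε ⊆ V ∧
      ∃ F : M → ℝ, ∀ y ∈ Metric.ball x ε, HasFDerivAt F (θ y) y) :
    ∃ g : M → ℝ, ∀ x ∈ V, HasFDerivAt g (θ x) x := by
  have := hVs.simplyConnectedSpace
  have := hV.locallyPathConnectedSpace
  choose! ε hε hεV F hF using hθ
  -- Two local primitives differ by a constant on the intersection of their balls, because that
  -- intersection is convex.
  have hconst (i j : V) {x y : M} (hx : x ∈ Metric.ball (i : M) (ε i) ∩ Metric.ball (j : M) (ε j))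
      (hy : y ∈ Metric.ball (i : M) (ε i) ∩ Metric.ball (j : M) (ε j)) :
      F i x - F j x = F i y - F j y := by
    refine (Metric.isOpen_ball.inter Metric.isOpen_ball).is_const_of_fderiv_eq_zero (𝕜 := ℝ)
      (f := fun x => F i x - F j x)
      ((convex_ball _ _).inter (convex_ball _ _)).isPreconnected (fun z hz => ?_)
      (fun z hz => ?_) hx hy
    · exact ((hF i i.2 z hz.1).sub (hF j j.2 z hz.2)).differentiableAt.differentiableWithinAt
    · exact ((hF i i.2 z hz.1).sub (hF j j.2 z hz.2)).fderiv.trans (by simp)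
  -- Fibre coordinate `v` in chart `i` stands for the germ of the primitive `F i + v`. The
  -- transition adds `F i - F j`, which is locally constant by `hconst` and hence continuous into
  -- the discrete fibre.
  let Z : FiberBundleCore V V DiscreteReal :=
    { baseSet := fun i => {x | (x : M) ∈ Metric.ball (i : M) (ε i)}
      isOpen_baseSet := fun i => Metric.isOpen_ball.preimage continuous_subtype_val
      indexAt := id
      mem_baseSet_at := fun x => Metric.mem_ball_self (hε x x.2)
      coordChange := fun i j x v => ⟨v.val + (F i x - F j x)⟩
      coordChange_self := fun i x _ v => by simp
      continuousOn_coordChange := fun i j => by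
        rintro ⟨x, v⟩ ⟨hx, -⟩
        have hc : Continuous (fun p : V × DiscreteReal =>
            (⟨p.2.val + (F i x - F j x)⟩ : DiscreteReal)) :=
          (continuous_of_discreteTopology (α := DiscreteReal)
            (f := fun v => (⟨v.val + (F i x - F j x)⟩ : DiscreteReal))).comp continuous_snd
        refine hc.continuousWithinAt.congr (fun p hp => ?_) rfl
        ext
        change p.2.val + (F i p.1 - F j p.1) = p.2.val + (F i x - F j x)
        rw [hconst i j hp.1 hx]
      coordChange_comp := fun i j k x _ v => by
        ext
        change v.val + (F i x - F j x) + (F j x - F k x) = v.val + (F i x - F k x)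
        ring }
  have hcov : IsCoveringMap Z.proj := FiberBundle.isCoveringMap (F := DiscreteReal) (E := Z.Fiber)
  obtain ⟨x₀, hx₀⟩ := hVs.nonempty
  -- The base is simply connected, so the identity lifts through the covering: this lift is a global
  -- choice of constants.
  obtain ⟨σ, ⟨-, hσ⟩, -⟩ := hcov.existsUnique_continuousMap_lifts (ContinuousMap.id V)
    ⟨x₀, hx₀⟩ ⟨⟨x₀, hx₀⟩, (⟨0⟩ : DiscreteReal)⟩ rfl
  have hσ' (x : V) : (σ x).1 = x := congr_fun hσ x
  classical
  -- Since `indexAt = id`, the fibre coordinate over `x` is read in the chart centred at `x`, where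
  -- the germ has value `F x x` plus that coordinate.
  let g : M → ℝ := fun x => if h : x ∈ V then (show DiscreteReal from (σ ⟨x, h⟩).2).val + F x x else 0
  refine ⟨g, fun x hx => ?_⟩
  let i : V := ⟨x, hx⟩
  let c : V → DiscreteReal := fun y => (Z.localTriv i (σ y)).2
  have hgc (y : V) : g y = (c y).val + F i y := by
    have h1 : (c y).val = (show DiscreteReal from (σ y).2).val + (F (σ y).1 (σ y).1 - F i (σ y).1) := rfl
    rw [hσ'] at h1
    have h2 : g y = (show DiscreteReal from (σ y).2).val + F y y := by simp [g]
    rw [h1, h2]; ring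
  have hc : ContinuousAt c i := by
    refine continuous_snd.continuousAt.comp (ContinuousAt.comp ?_ σ.continuous.continuousAt)
    refine (Z.localTriv i).continuousAt ?_
    rw [(Z.localTriv i).mem_source]
    change ((σ i).1 : M) ∈ Metric.ball (i : M) (ε i)
    rw [hσ']
    exact Metric.mem_ball_self (hε x hx)
  -- A continuous map into a discrete space is locally constant; hence `g` is `F i` plus a constant
  -- near `x`.
  have hev : ∀ᶠ y in 𝓝 i, c y = c i := hc.eventually_mem (by simp [nhds_discrete] : {c i} ∈ 𝓝 (c i))
  have hev' : ∀ᶠ y in 𝓝 x, g y = (c i).val + F i y := by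
    rw [nhds_subtype_eq_comap, eventually_comap] at hev
    filter_upwards [hev, hV.mem_nhds hx] with y hy hyV
    rw [← hy ⟨y, hyV⟩ rfl]
    exact hgc ⟨y, hyV⟩
  exact ((hF x hx x (Metric.mem_ball_self (hε x hx))).const_add _).congr_of_eventuallyEq hev'

/-- The Poincaré lemma for one-forms on simply connected open sets. -/
theorem exists_primitive_of_fderiv_symmetric {M : Type*} [NormedAddCommGroup M] [NormedSpace ℝ M]
    {V : Set M} (hV : IsOpen V) (hVs : IsSimplyConnected V) {θ : M → M →L[ℝ] ℝ}
    (hθ : DifferentiableOn ℝ θ V)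
    (hdθ : ∀ a ∈ V, ∀ x y, fderiv ℝ θ a x y = fderiv ℝ θ a y x) :
    ∃ g : M → ℝ, ∀ x ∈ V, HasFDerivAt g (θ x) x := by
  refine exists_primitive_of_local hV hVs fun x hx => ?_
  obtain ⟨ε, hε, hb⟩ := Metric.isOpen_iff.mp hV x hx
  exact ⟨ε, hε, hb, (convex_ball x ε).exists_forall_hasFDerivAt_of_fderiv_symmetric
    Metric.isOpen_ball (hθ.mono hb) fun a ha => hdθ a (hb ha)⟩

/-- The Poincaré lemma in the plane, in coordinates. -/
theorem exists_hasPartials {V : Set Plane} (hV : IsOpen V) (hVs : IsSimplyConnected V)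
    {a b a₁ a₂ b₁ b₂ : Plane → ℝ} (ha : ∀ p ∈ V, HasPartials a (a₁ p) (a₂ p) p)
    (hb : ∀ p ∈ V, HasPartials b (b₁ p) (b₂ p) p) (hab : ∀ p ∈ V, a₂ p = b₁ p) :
    ∃ g : Plane → ℝ, ∀ p ∈ V, HasPartials g (a p) (b p) p := by
  let F : ℝ →L[ℝ] Plane →L[ℝ] ℝ := ContinuousLinearMap.smulRightL ℝ Plane ℝ dX
  let G : ℝ →L[ℝ] Plane →L[ℝ] ℝ := ContinuousLinearMap.smulRightL ℝ Plane ℝ dY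
  have hd (p : Plane) (hp : p ∈ V) :
      HasFDerivAt (fun q => dX.smulRight (a q) + dY.smulRight (b q))
        (F.comp (dX.smulRight (a₁ p) + dY.smulRight (a₂ p))
          + G.comp (dX.smulRight (b₁ p) + dY.smulRight (b₂ p))) p :=
    HasFDerivAt.add (F.hasFDerivAt.comp p (ha p hp)) (G.hasFDerivAt.comp p (hb p hp))
  refine exists_primitive_of_fderiv_symmetric hV hVs
    (fun p hp => (hd p hp).differentiableAt.differentiableWithinAt) fun p hp x y => ?_
  rw [(hd p hp).fderiv]
  simp [F, G, dX, dY, hab p hp]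
  ring

/-! ### The principal frame -/

/-- The orthonormal frame `n, t₂, t₃` of a surface in conformal principal coordinates, with its
structure equations. -/
structure PrincipalFrame (U : Set Plane) (f n t₂ t₃ : Plane → E3) (u h₁ h₂ : Plane → ℝ) :
    Prop where
  smooth_f : ContDiffOn ℝ ∞ f U
  smooth_n : ContDiffOn ℝ ∞ n U
  smooth_t₂ : ContDiffOn ℝ ∞ t₂ U
  smooth_t₃ : ContDiffOn ℝ ∞ t₃ U
  smooth_u : ContDiffOn ℝ ∞ u U
  n_n : ∀ p ∈ U, inner ℝ (n p) (n p) = (1 : ℝ)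
  t₂_t₂ : ∀ p ∈ U, inner ℝ (t₂ p) (t₂ p) = (1 : ℝ)
  t₃_t₃ : ∀ p ∈ U, inner ℝ (t₃ p) (t₃ p) = (1 : ℝ)
  n_t₂ : ∀ p ∈ U, inner ℝ (n p) (t₂ p) = (0 : ℝ)
  n_t₃ : ∀ p ∈ U, inner ℝ (n p) (t₃ p) = (0 : ℝ)
  t₂_t₃ : ∀ p ∈ U, inner ℝ (t₂ p) (t₃ p) = (0 : ℝ)
  df : ∀ p ∈ U, HasPartials f (h₁ p • t₂ p) (h₂ p • t₃ p) p
  dn : ∀ p ∈ U, HasPartials n (Real.exp (u p) • t₂ p) (Real.exp (u p) • t₃ p) p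
  dt₂ : ∀ p ∈ U, HasPartials t₂ (-(Real.exp (u p)) • n p - ddy u p • t₃ p) (ddx u p • t₃ p) p
  dt₃ : ∀ p ∈ U, HasPartials t₃ (ddy u p • t₂ p) (-(Real.exp (u p)) • n p - ddx u p • t₂ p) p

/-! ### Coordinate directions as curvature directions. -/

namespace IsLIsothermicLegendre

variable {U : Set Plane} {f n : Plane → E3} {p : Plane}

theorem hasPartials_f (h : IsLIsothermicLegendre U f n) (hU : IsOpen U) (hp : p ∈ U) :
    HasPartials f (ddx f p) (ddy f p) p := hasPartials_of_contDiffOn hU h.smooth_f hp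

theorem hasPartials_n (h : IsLIsothermicLegendre U f n) (hU : IsOpen U) (hp : p ∈ U) :
    HasPartials n (ddx n p) (ddy n p) p := hasPartials_of_contDiffOn hU h.smooth_n hp

theorem inner_n_n (h : IsLIsothermicLegendre U f n) (hp : p ∈ U) :
    inner ℝ (n p) (n p) = (1 : ℝ) := by
  rw [real_inner_self_eq_norm_sq, h.unit p hp, one_pow]

theorem inner_ddx_n (h : IsLIsothermicLegendre U f n) (hU : IsOpen U) (hp : p ∈ U) :
    inner ℝ (n p) (ddx n p) = (0 : ℝ) := by
  have hn := h.hasPartials_n hU hp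
  have := (hn.inner_const hU hp hn fun q hq => h.inner_n_n hq).1
  rw [real_inner_comm] at this
  linarith

theorem inner_ddy_n (h : IsLIsothermicLegendre U f n) (hU : IsOpen U) (hp : p ∈ U) :
    inner ℝ (n p) (ddy n p) = (0 : ℝ) := by
  have hn := h.hasPartials_n hU hp
  have := (hn.inner_const hU hp hn fun q hq => h.inner_n_n hq).2
  rw [real_inner_comm] at this
  linarith

theorem inner_ddx_n_ddy_n (h : IsLIsothermicLegendre U f n) (hp : p ∈ U) :
    inner ℝ (ddx n p) (ddy n p) = (0 : ℝ) := (h.third_conformal p hp).2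

theorem inner_ddx_f_n (h : IsLIsothermicLegendre U f n) (hp : p ∈ U) :
    inner ℝ (ddx f p) (n p) = (0 : ℝ) := h.legendre p hp _

theorem inner_ddy_f_n (h : IsLIsothermicLegendre U f n) (hp : p ∈ U) :
    inner ℝ (ddy f p) (n p) = (0 : ℝ) := h.legendre p hp _

/-- The imaginary part of the Hopf coefficient is minus half the mixed coefficient of `II`, so its
reality is exactly this orthogonality. -/
theorem inner_ddx_f_ddy_n (h : IsLIsothermicLegendre U f n) (hp : p ∈ U) :
    inner ℝ (ddx f p) (ddy n p) = (0 : ℝ) := by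
  obtain ⟨μ, -, hμ⟩ := h.hopf_real
  have := congrArg Complex.im (hμ p hp)
  simp only [hopfCoeff, Complex.sub_im, Complex.ofReal_im, Complex.mul_im, Complex.I_re,
    Complex.I_im, Complex.ofReal_re, secondForm] at this
  change inner ℝ (fderiv ℝ f p (1, 0)) (fderiv ℝ n p (0, 1)) = (0 : ℝ)
  linarith

/-- The symmetry of the second fundamental form. -/
theorem inner_ddy_f_ddx_n (h : IsLIsothermicLegendre U f n) (hU : IsOpen U) (hp : p ∈ U) :
    inner ℝ (ddy f p) (ddx n p) = (0 : ℝ) := by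
  have hx := hasPartials_of_contDiffOn hU (contDiffOn_ddx hU h.smooth_f) hp
  have hy := hasPartials_of_contDiffOn hU (contDiffOn_ddy hU h.smooth_f) hp
  have hn := h.hasPartials_n hU hp
  -- Differentiating `f_x · n = 0` in `y` and `f_y · n = 0` in `x`, and using `f_xy = f_yx`, gives
  -- `f_x · n_y = f_y · n_x`.
  have h1 := (hx.inner_const hU hp hn fun q hq => h.inner_ddx_f_n hq).2
  have h2 := (hy.inner_const hU hp hn fun q hq => h.inner_ddy_f_n hq).1
  have h3 := HasPartials.symm hU hp (fun q hq => h.hasPartials_f hU hq) hx hy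
  rw [h.inner_ddx_f_ddy_n hp, h3] at h1
  linarith

theorem inner_ddx_n_pos (h : IsLIsothermicLegendre U f n) (hp : p ∈ U) :
    0 < (inner ℝ (ddx n p) (ddx n p) : ℝ) := h.third_pos p hp _ (by simp)

theorem inner_ddy_n_self (h : IsLIsothermicLegendre U f n) (hp : p ∈ U) :
    (inner ℝ (ddy n p) (ddy n p) : ℝ) = inner ℝ (ddx n p) (ddx n p) :=
  (h.third_conformal p hp).1.symm

theorem inner_ddy_n_pos (h : IsLIsothermicLegendre U f n) (hp : p ∈ U) :
    0 < (inner ℝ (ddy n p) (ddy n p) : ℝ) := h.third_pos p hp _ (by simp)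

/-- `f_x` is orthogonal to `n` and `n_y`, and `n, n_x, n_y` is an orthogonal basis. The factor may
vanish, as `f` may be singular here. -/
theorem exists_ddx_f_eq_smul (h : IsLIsothermicLegendre U f n) (hU : IsOpen U) (hp : p ∈ U) :
    ∃ c : ℝ, ddx f p = c • ddx n p := by
  have hx := (h.inner_ddx_n_pos hp).ne'
  refine ⟨inner ℝ (ddx f p) (ddx n p) / inner ℝ (ddx n p) (ddx n p),
    eq_of_inner_eq_of_orthogonal (e₁ := n p) (e₂ := ddx n p) (e₃ := ddy n p)
      (by rw [h.inner_n_n hp]; exact one_ne_zero) hx (h.inner_ddy_n_pos hp).ne'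
      (h.inner_ddx_n hU hp) (h.inner_ddy_n hU hp) (h.inner_ddx_n_ddy_n hp) ?_ ?_ ?_⟩
  · rw [real_inner_smul_left, real_inner_comm (n p) (ddx n p), h.inner_ddx_n hU hp,
      h.inner_ddx_f_n hp, mul_zero]
  · rw [real_inner_smul_left]; field_simp
  · rw [real_inner_smul_left, h.inner_ddx_n_ddy_n hp, h.inner_ddx_f_ddy_n hp, mul_zero]

theorem exists_ddy_f_eq_smul (h : IsLIsothermicLegendre U f n) (hU : IsOpen U) (hp : p ∈ U) :
    ∃ c : ℝ, ddy f p = c • ddy n p := by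
  have hy := (h.inner_ddy_n_pos hp).ne'
  refine ⟨inner ℝ (ddy f p) (ddy n p) / inner ℝ (ddy n p) (ddy n p),
    eq_of_inner_eq_of_orthogonal (e₁ := n p) (e₂ := ddx n p) (e₃ := ddy n p)
      (by rw [h.inner_n_n hp]; exact one_ne_zero) (h.inner_ddx_n_pos hp).ne' hy
      (h.inner_ddx_n hU hp) (h.inner_ddy_n hU hp) (h.inner_ddx_n_ddy_n hp) ?_ ?_ ?_⟩
  · rw [real_inner_smul_left, real_inner_comm (n p) (ddy n p), h.inner_ddy_n hU hp,
      h.inner_ddy_f_n hp, mul_zero]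
  · rw [real_inner_smul_left, h.inner_ddy_f_ddx_n hU hp,
      real_inner_comm (ddx n p), h.inner_ddx_n_ddy_n hp, mul_zero]
  · rw [real_inner_smul_left]; field_simp

end IsLIsothermicLegendre

/-- The sign of `v · w` is the sign of `c`, so it corrects the direction of `v / ‖v‖` to that of `w
/ ‖w‖`. Applied with `w = n_x` or `n_y`, it shows that the signs `ε₁, ε₂` do what the definition of
the frame intends. -/
theorem sign_smul_normalize {v w : E3} {c : ℝ} (hv : v = c • w) (hv0 : v ≠ 0) :
    (Real.sign (inner ℝ v w) * ‖v‖⁻¹) • v = ‖w‖⁻¹ • w ∧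
      (Real.sign (inner ℝ v w) * ‖v‖) • (‖w‖⁻¹ • w) = v := by
  subst hv
  have hc : c ≠ 0 := fun h => hv0 (by simp [h])
  have hw : ‖w‖ ≠ 0 := fun h => hv0 (by simp [norm_eq_zero.mp h])
  have hw' : 0 < ‖w‖ := lt_of_le_of_ne (norm_nonneg _) hw.symm
  have key : Real.sign (inner ℝ (c • w) w) * |c| = c ∧
      Real.sign (inner ℝ (c • w) w) * |c|⁻¹ = c⁻¹ := by
    rw [real_inner_smul_left, real_inner_self_eq_norm_sq]
    rcases hc.lt_or_gt with h | h
    · rw [Real.sign_of_neg (mul_neg_of_neg_of_pos h (by positivity)), abs_of_neg h]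
      exact ⟨by ring, by field_simp⟩
    · rw [Real.sign_of_pos (by positivity), abs_of_pos h]
      exact ⟨by ring, by field_simp⟩
  obtain ⟨k₁, k₂⟩ := key
  have k₃ : Real.sign (inner ℝ (c • w) w) * ‖c • w‖ = c * ‖w‖ := by
    rw [norm_smul, Real.norm_eq_abs, ← mul_assoc, k₁]
  refine ⟨?_, ?_⟩
  · rw [norm_smul, Real.norm_eq_abs, smul_smul, mul_inv, ← mul_assoc, k₂]
    congr 1; field_simp
  · rw [k₃, smul_smul]; congr 1; field_simp

/-! ### The adapted frame of the immersion. -/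

namespace IsLIsothermicImmersion

variable {U : Set Plane} {f : Plane → E3} {p : Plane}

theorem ddx_ne_zero (hf : IsLIsothermicImmersion U f) (hp : p ∈ U) : ddx f p ≠ 0 := fun h => by
  have := hf.immersion p hp (a₁ := (1, 0)) (a₂ := 0) (by rw [map_zero]; exact h)
  simp at this

theorem ddy_ne_zero (hf : IsLIsothermicImmersion U f) (hp : p ∈ U) : ddy f p ≠ 0 := fun h => by
  have := hf.immersion p hp (a₁ := (0, 1)) (a₂ := 0) (by rw [map_zero]; exact h)
  simp at this

theorem norm_ddx_normal_pos (hf : IsLIsothermicImmersion U f) (hp : p ∈ U) :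
    0 < ‖ddx (unitNormal f) p‖ := by
  have := hf.legendre.inner_ddx_n_pos hp
  rw [real_inner_self_eq_norm_sq] at this
  exact lt_of_le_of_ne (norm_nonneg _) fun h => by simp [← h] at this

theorem norm_ddy_normal (hf : IsLIsothermicImmersion U f) (hp : p ∈ U) :
    ‖ddy (unitNormal f) p‖ = ‖ddx (unitNormal f) p‖ := by
  have := hf.legendre.inner_ddy_n_self hp
  rwa [real_inner_self_eq_norm_sq, real_inner_self_eq_norm_sq,
    sq_eq_sq₀ (norm_nonneg _) (norm_nonneg _)] at this

theorem exp_confFactor (hf : IsLIsothermicImmersion U f) (hp : p ∈ U) :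
    Real.exp (confFactor f p) = ‖ddx (unitNormal f) p‖ :=
  Real.exp_log (hf.norm_ddx_normal_pos hp)

/-- The frame and its structure equations (Gauss and Weingarten formulas). -/
theorem principalFrame (hf : IsLIsothermicImmersion U f) (hU : IsOpen U) :
    PrincipalFrame U f (unitNormal f) (frame₂ f) (frame₃ f) (confFactor f) (h₁ f) (h₂ f) := by
  have H := hf.legendre
  have sx := contDiffOn_ddx hU H.smooth_n
  have sy := contDiffOn_ddy hU H.smooth_n
  have snorm : ContDiffOn ℝ ∞ (fun p => ‖ddx (unitNormal f) p‖) U :=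
    sx.norm ℝ fun p hp => norm_pos_iff.mp (hf.norm_ddx_normal_pos hp)
  have sinv : ContDiffOn ℝ ∞ (fun p => ‖ddx (unitNormal f) p‖⁻¹) U :=
    snorm.inv fun p hp => (hf.norm_ddx_normal_pos hp).ne'
  have ex (p) (hp : p ∈ U) := sign_smul_normalize
    (H.exists_ddx_f_eq_smul hU hp).choose_spec (hf.ddx_ne_zero hp)
  have ey (p) (hp : p ∈ U) := sign_smul_normalize
    (H.exists_ddy_f_eq_smul hU hp).choose_spec (hf.ddy_ne_zero hp)
  have et₂ : ∀ p ∈ U, frame₂ f p = ‖ddx (unitNormal f) p‖⁻¹ • ddx (unitNormal f) p := fun p hp => (ex p hp).1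
  have et₃ : ∀ p ∈ U, frame₃ f p = ‖ddx (unitNormal f) p‖⁻¹ • ddy (unitNormal f) p := fun p hp => by
    rw [← hf.norm_ddy_normal hp]; exact (ey p hp).1
  have st₂ : ContDiffOn ℝ ∞ (frame₂ f) U := (sinv.smul sx).congr et₂
  have st₃ : ContDiffOn ℝ ∞ (frame₃ f) U := (sinv.smul sy).congr et₃
  have su : ContDiffOn ℝ ∞ (confFactor f) U :=
    snorm.log fun p hp => (hf.norm_ddx_normal_pos hp).ne'
  have nx : ∀ p ∈ U, ddx (unitNormal f) p = Real.exp (confFactor f p) • frame₂ f p := fun p hp => by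
    rw [hf.exp_confFactor hp, et₂ p hp, smul_smul,
      mul_inv_cancel₀ (hf.norm_ddx_normal_pos hp).ne', one_smul]
  have ny : ∀ p ∈ U, ddy (unitNormal f) p = Real.exp (confFactor f p) • frame₃ f p := fun p hp => by
    rw [hf.exp_confFactor hp, et₃ p hp, smul_smul,
      mul_inv_cancel₀ (hf.norm_ddx_normal_pos hp).ne', one_smul]
  have dn : ∀ p ∈ U, HasPartials (unitNormal f) (Real.exp (confFactor f p) • frame₂ f p)
      (Real.exp (confFactor f p) • frame₃ f p) p := fun p hp =>
    (H.hasPartials_n hU hp).congr_partials (nx p hp) (ny p hp)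
  have n_n : ∀ p ∈ U, inner ℝ (unitNormal f p) (unitNormal f p) = (1 : ℝ) := fun p hp => H.inner_n_n hp
  have t₂_t₂ : ∀ p ∈ U, inner ℝ (frame₂ f p) (frame₂ f p) = (1 : ℝ) := fun p hp => by
    have := (hf.norm_ddx_normal_pos hp).ne'
    rw [et₂ p hp, real_inner_smul_left, real_inner_smul_right, real_inner_self_eq_norm_sq]
    field_simp
  have t₃_t₃ : ∀ p ∈ U, inner ℝ (frame₃ f p) (frame₃ f p) = (1 : ℝ) := fun p hp => by
    have := (hf.norm_ddx_normal_pos hp).ne'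
    rw [et₃ p hp, real_inner_smul_left, real_inner_smul_right, real_inner_self_eq_norm_sq,
      hf.norm_ddy_normal hp]
    field_simp
  have n_t₂ : ∀ p ∈ U, inner ℝ (unitNormal f p) (frame₂ f p) = (0 : ℝ) := fun p hp => by
    rw [et₂ p hp, real_inner_smul_right, H.inner_ddx_n hU hp, mul_zero]
  have n_t₃ : ∀ p ∈ U, inner ℝ (unitNormal f p) (frame₃ f p) = (0 : ℝ) := fun p hp => by
    rw [et₃ p hp, real_inner_smul_right, H.inner_ddy_n hU hp, mul_zero]
  have t₂_t₃ : ∀ p ∈ U, inner ℝ (frame₂ f p) (frame₃ f p) = (0 : ℝ) := fun p hp => by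
    rw [et₂ p hp, et₃ p hp, real_inner_smul_right, real_inner_smul_left,
      H.inner_ddx_n_ddy_n hp, mul_zero, mul_zero]
  have key (p) (hp : p ∈ U) :
      (ddx (frame₂ f) p = -(Real.exp (confFactor f p)) • unitNormal f p - ddy (confFactor f) p • frame₃ f p ∧
        ddy (frame₂ f) p = ddx (confFactor f) p • frame₃ f p) ∧
      (ddx (frame₃ f) p = ddy (confFactor f) p • frame₂ f p ∧
        ddy (frame₃ f) p =
          -(Real.exp (confFactor f p)) • unitNormal f p - ddx (confFactor f) p • frame₂ f p) := by
    have d₂ := hasPartials_of_contDiffOn hU st₂ hp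
    have d₃ := hasPartials_of_contDiffOn hU st₃ hp
    have du := (hasPartials_of_contDiffOn hU su hp).exp
    have hE := (Real.exp_pos (confFactor f p)).ne'
    obtain ⟨a₁, a₂⟩ := d₂.inner_const hU hp d₂ t₂_t₂
    obtain ⟨b₁, b₂⟩ := d₃.inner_const hU hp d₃ t₃_t₃
    obtain ⟨c₁, c₂⟩ := (dn p hp).inner_const hU hp d₂ n_t₂
    obtain ⟨e₁, e₂⟩ := (dn p hp).inner_const hU hp d₃ n_t₃
    obtain ⟨g₁, g₂⟩ := d₂.inner_const hU hp d₃ t₂_t₃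
    -- `n_xy = n_yx` reads `(e^u t₂)_y = (e^u t₃)_x`. Its `t₃` and `t₂` components give `t₂_y · t₃ =
    -- u_x` and `t₃_x · t₂ = u_y`; the other components follow from orthonormality.
    have hs := HasPartials.symm hU hp dn (du.smul d₂) (du.smul d₃)
    have hs₂ := congrArg (fun w => inner ℝ w (frame₂ f p)) hs
    have hs₃ := congrArg (fun w => inner ℝ w (frame₃ f p)) hs
    have q₁ := t₂_t₂ p hp
    have q₂ := t₃_t₃ p hp
    have q₃ := t₂_t₃ p hp
    have q₄ := n_t₂ p hp
    have q₅ := n_t₃ p hp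
    have q₆ := n_n p hp
    have q₃' : inner ℝ (frame₃ f p) (frame₂ f p) = (0 : ℝ) := by rw [real_inner_comm, q₃]
    have q₄' : inner ℝ (frame₂ f p) (unitNormal f p) = (0 : ℝ) := by rw [real_inner_comm, q₄]
    have q₅' : inner ℝ (frame₃ f p) (unitNormal f p) = (0 : ℝ) := by rw [real_inner_comm, q₅]
    rw [real_inner_comm _ (frame₂ f p)] at a₁ a₂
    rw [real_inner_comm _ (frame₃ f p)] at b₁ b₂
    rw [real_inner_comm _ (unitNormal f p)] at c₁ c₂ e₁ e₂
    rw [real_inner_comm (ddx (frame₃ f) p)] at g₁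
    rw [real_inner_comm (ddy (frame₃ f) p)] at g₂
    simp only [inner_add_left, real_inner_smul_left, q₁, q₂, q₃, q₃'] at hs₂ hs₃ c₁ c₂ e₁ e₂
    have q₇ : inner ℝ (ddy (frame₂ f) p) (frame₃ f p) = ddx (confFactor f) p :=
      mul_left_cancel₀ hE
        (by linear_combination hs₃ + Real.exp (confFactor f p) / 2 * b₁)
    have q₈ : inner ℝ (ddx (frame₃ f) p) (frame₂ f p) = ddy (confFactor f) p :=
      mul_left_cancel₀ hE
        (by linear_combination -hs₂ + Real.exp (confFactor f p) / 2 * a₂)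
    constructor <;> constructor <;>
      apply eq_of_inner_eq q₆ q₁ q₂ q₄ q₅ q₃ <;>
      simp only [inner_sub_left, real_inner_smul_left, q₁, q₂, q₃, q₄, q₅, q₆, q₃', q₄', q₅'] <;>
      linarith
  refine ⟨H.smooth_f, H.smooth_n, st₂, st₃, su, n_n, t₂_t₂, t₃_t₃, n_t₂, n_t₃, t₂_t₃,
    fun p hp => ?_, dn, fun p hp => ?_, fun p hp => ?_⟩
  · refine (H.hasPartials_f hU hp).congr_partials ?_ ?_
    · rw [et₂ p hp]; exact (ex p hp).2.symm
    · rw [et₃ p hp, ← hf.norm_ddy_normal hp]; exact (ey p hp).2.symm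
  · exact (hasPartials_of_contDiffOn hU st₂ hp).congr_partials (key p hp).1.1 (key p hp).1.2
  · exact (hasPartials_of_contDiffOn hU st₃ hp).congr_partials (key p hp).2.1 (key p hp).2.2

end IsLIsothermicImmersion

/-! ### The Riccati system -/

/-- Solutions of the linear system in the affine chart
`a = v² / (√2 v⁴)`, `b = v³ / (√2 v⁴)`, `ρ = - r / (√2 v⁴)` of the light cone, for which the
congruence of spheres of radius `ρ` tangent to `f` is immersed. -/
structure RiccatiSolution (U : Set Plane) (u h₁ h₂ : Plane → ℝ) (m : ℝ) (a b ρ : Plane → ℝ) :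
    Prop where
  m_ne : m ≠ 0
  smooth_a : ContDiffOn ℝ ∞ a U
  smooth_b : ContDiffOn ℝ ∞ b U
  smooth_ρ : ContDiffOn ℝ ∞ ρ U
  da : ∀ p ∈ U, HasPartials a
    (Real.exp (u p) / 2 * (1 + a p ^ 2 - b p ^ 2) - m / (2 * Real.exp (u p)) - ddy u p * b p)
    (ddx u p * b p + Real.exp (u p) * a p * b p) p
  db : ∀ p ∈ U, HasPartials b (ddy u p * a p + Real.exp (u p) * a p * b p)
    (Real.exp (u p) / 2 * (1 + b p ^ 2 - a p ^ 2) + m / (2 * Real.exp (u p)) - ddx u p * a p) p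
  dρ : ∀ p ∈ U, HasPartials ρ (-(h₁ p - ρ p * Real.exp (u p)) * a p)
    (-(h₂ p - ρ p * Real.exp (u p)) * b p) p
  ne₁ : ∀ p ∈ U, h₁ p - ρ p * Real.exp (u p) ≠ 0
  ne₂ : ∀ p ∈ U, h₂ p - ρ p * Real.exp (u p) ≠ 0

/-- The unit normal of the second envelope. -/
def reflectedNormal (n t₂ t₃ : Plane → E3) (a b : Plane → ℝ) (p : Plane) : E3 :=
  n p + (2 / (1 + a p ^ 2 + b p ^ 2)) • (-n p + a p • t₂ p + b p • t₃ p)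

/-- The spheres of radius `ρ` tangent to `(f, n)`. -/
def tangentSpheres (f n : Plane → E3) (ρ : Plane → ℝ) (p : Plane) : Mink :=
  (f p - ρ p • n p, ρ p)

/-- The orthonormal pair `e₂, e₃` diagonalizes `df` and `dn` at once: `l² = k²` is conformality, and
the vanishing mixed term makes the Hopf coefficient real. The sign of `l` relative to `k` is left
free because the second envelope has `l = -k`; `α, β` may vanish. -/
theorem IsLIsothermicLegendre.of_hasPartials {U : Set Plane} {f n e₂ e₃ : Plane → E3}
    {α β k l : Plane → ℝ} (hU : IsOpen U) (sf : ContDiffOn ℝ ∞ f U) (sn : ContDiffOn ℝ ∞ n U)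
    (hn : ∀ p ∈ U, inner ℝ (n p) (n p) = (1 : ℝ)) (h₂ : ∀ p ∈ U, inner ℝ (e₂ p) (e₂ p) = (1 : ℝ))
    (h₃ : ∀ p ∈ U, inner ℝ (e₃ p) (e₃ p) = (1 : ℝ))
    (h₂₃ : ∀ p ∈ U, inner ℝ (e₂ p) (e₃ p) = (0 : ℝ)) (hk : ∀ p ∈ U, k p ≠ 0)
    (hl : ∀ p ∈ U, l p ^ 2 = k p ^ 2)
    (dn : ∀ p ∈ U, HasPartials n (k p • e₂ p) (l p • e₃ p) p)
    (df : ∀ p ∈ U, HasPartials f (α p • k p • e₂ p) (β p • l p • e₃ p) p) :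
    IsLIsothermicLegendre U f n := by
  have h₃₂ : ∀ p ∈ U, inner ℝ (e₃ p) (e₂ p) = (0 : ℝ) := fun p hp => by
    rw [real_inner_comm, h₂₃ p hp]
  have e0 : ∀ p ∈ U, k p * inner ℝ (e₂ p) (n p) = 0 ∧ l p * inner ℝ (e₃ p) (n p) = 0 :=
    fun p hp => by
      have := (dn p hp).inner_const hU hp (dn p hp) hn
      simp only [real_inner_smul_left, real_inner_comm _ (n p)] at this
      exact ⟨by linarith [this.1], by linarith [this.2]⟩
  have hIII (p) (hp : p ∈ U) (X Y : Plane) :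
      thirdForm n p X Y = k p ^ 2 * (X.1 * Y.1 + X.2 * Y.2) := by
    simp only [thirdForm, (dn p hp).fderiv_apply, inner_add_left, inner_add_right,
      real_inner_smul_left, real_inner_smul_right, h₂ p hp, h₃ p hp, h₂₃ p hp, h₃₂ p hp]
    linear_combination X.2 * Y.2 * hl p hp
  refine ⟨sf, sn, fun p hp => ?_, fun p hp X => ?_, fun p hp X hX => ?_, fun p hp => ?_, ?_⟩
  · have := hn p hp
    rw [real_inner_self_eq_norm_sq] at this
    exact (pow_eq_one_iff_of_nonneg (norm_nonneg _) two_ne_zero).mp this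
  · simp only [(df p hp).fderiv_apply, inner_add_left, real_inner_smul_left]
    linear_combination X.1 * α p * (e0 p hp).1 + X.2 * β p * (e0 p hp).2
  · rw [hIII p hp]
    have h0 : 0 < k p ^ 2 := by have := hk p hp; positivity
    refine mul_pos h0 ?_
    rcases eq_or_ne X.1 0 with h | h
    · have : X.2 ≠ 0 := fun h' => hX (Prod.ext h h')
      nlinarith [sq_pos_of_ne_zero this]
    · nlinarith [sq_pos_of_ne_zero h]
  · rw [hIII p hp, hIII p hp, hIII p hp]; simp
  · refine ⟨fun p => (secondForm f n p (1, 0) (1, 0) - secondForm f n p (0, 1) (0, 1)) / 4,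
      ?_, fun p hp => ?_⟩
    · have h1 := (contDiffOn_ddx hU sf).inner ℝ (contDiffOn_ddx hU sn)
      have h2 := (contDiffOn_ddy hU sf).inner ℝ (contDiffOn_ddy hU sn)
      exact (h1.neg.sub h2.neg).div_const 4
    · have : secondForm f n p (1, 0) (0, 1) = 0 := by
        simp [secondForm, (df p hp).fderiv_apply, (dn p hp).fderiv_apply, real_inner_smul_left,
          real_inner_smul_right, h₂₃ p hp]
      simp [hopfCoeff, this]

namespace PrincipalFrame

variable {U V : Set Plane} {f n t₂ t₃ : Plane → E3} {u h₁ h₂ : Plane → ℝ} {p : Plane}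

theorem hasPartials_u (F : PrincipalFrame U f n t₂ t₃ u h₁ h₂) (hU : IsOpen U) (hp : p ∈ U) :
    HasPartials u (ddx u p) (ddy u p) p := hasPartials_of_contDiffOn hU F.smooth_u hp

theorem mono (F : PrincipalFrame U f n t₂ t₃ u h₁ h₂) (hVU : V ⊆ U) :
    PrincipalFrame V f n t₂ t₃ u h₁ h₂ :=
  ⟨F.smooth_f.mono hVU, F.smooth_n.mono hVU, F.smooth_t₂.mono hVU, F.smooth_t₃.mono hVU,
    F.smooth_u.mono hVU,
    fun p hp => F.n_n p (hVU hp), fun p hp => F.t₂_t₂ p (hVU hp), fun p hp => F.t₃_t₃ p (hVU hp),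
    fun p hp => F.n_t₂ p (hVU hp), fun p hp => F.n_t₃ p (hVU hp), fun p hp => F.t₂_t₃ p (hVU hp),
    fun p hp => F.df p (hVU hp), fun p hp => F.dn p (hVU hp), fun p hp => F.dt₂ p (hVU hp),
    fun p hp => F.dt₃ p (hVU hp)⟩

theorem t₂_n (F : PrincipalFrame U f n t₂ t₃ u h₁ h₂) (hp : p ∈ U) :
    inner ℝ (t₂ p) (n p) = (0 : ℝ) := by rw [real_inner_comm, F.n_t₂ p hp]

theorem t₃_n (F : PrincipalFrame U f n t₂ t₃ u h₁ h₂) (hp : p ∈ U) :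
    inner ℝ (t₃ p) (n p) = (0 : ℝ) := by rw [real_inner_comm, F.n_t₃ p hp]

theorem t₃_t₂ (F : PrincipalFrame U f n t₂ t₃ u h₁ h₂) (hp : p ∈ U) :
    inner ℝ (t₃ p) (t₂ p) = (0 : ℝ) := by rw [real_inner_comm, F.t₂_t₃ p hp]

/-- The equation for `dρ` is what makes both partial derivatives proportional to `(t₂ + a n, -a)`
and `(t₃ + b n, -b)`, which are Lorentz-orthonormal. So the congruence is immersed, and then
automatically space-like, exactly where both factors are nonzero. -/
theorem hasPartials_tangentSpheres (F : PrincipalFrame U f n t₂ t₃ u h₁ h₂) (hp : p ∈ U)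
    {ρ a b : Plane → ℝ} (hρ : HasPartials ρ (-(h₁ p - ρ p * Real.exp (u p)) * a p)
      (-(h₂ p - ρ p * Real.exp (u p)) * b p) p) :
    HasPartials (tangentSpheres f n ρ)
      ((h₁ p - ρ p * Real.exp (u p)) • (t₂ p + a p • n p, -a p))
      ((h₂ p - ρ p * Real.exp (u p)) • (t₃ p + b p • n p, -b p)) p := by
  refine (((F.df p hp).sub (hρ.smul (F.dn p hp))).prodMk hρ).congr_partials ?_ ?_ <;>
  · refine Prod.ext ?_ (by simp only [Prod.smul_snd, smul_eq_mul]; ring)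
    change _ = _ • (_ : E3)
    simp only
    module

end PrincipalFrame

/-! ### From the Riccati system to a Bianchi–Darboux pair. -/

namespace RiccatiSolution

variable {U : Set Plane} {f n t₂ t₃ : Plane → E3} {u h₁ h₂ : Plane → ℝ} {m : ℝ}
  {a b ρ : Plane → ℝ} {p : Plane}

theorem mono (R : RiccatiSolution U u h₁ h₂ m a b ρ) {V : Set Plane} (hVU : V ⊆ U) :
    RiccatiSolution V u h₁ h₂ m a b ρ :=
  ⟨R.m_ne, R.smooth_a.mono hVU, R.smooth_b.mono hVU, R.smooth_ρ.mono hVU,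
    fun p hp => R.da p (hVU hp), fun p hp => R.db p (hVU hp), fun p hp => R.dρ p (hVU hp),
    fun p hp => R.ne₁ p (hVU hp), fun p hp => R.ne₂ p (hVU hp)⟩

/-- The terms of the Riccati system without `m` describe a constant `N`. As `∂N/∂a = D τ₂` and
`∂N/∂b = D τ₃`, the remaining terms `-m / (2 e^u)` in `a_x` and `m / (2 e^u)` in `b_y` give the two
derivatives, with opposite signs. -/
theorem hasPartials_reflectedNormal (R : RiccatiSolution U u h₁ h₂ m a b ρ)
    (F : PrincipalFrame U f n t₂ t₃ u h₁ h₂) (hp : p ∈ U) :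
    HasPartials (reflectedNormal n t₂ t₃ a b)
      ((-(m / (Real.exp (u p) * (1 + a p ^ 2 + b p ^ 2)))) •
        (t₂ p - a p • (reflectedNormal n t₂ t₃ a b p - n p)))
      ((m / (Real.exp (u p) * (1 + a p ^ 2 + b p ^ 2))) •
        (t₃ p - b p • (reflectedNormal n t₂ t₃ a b p - n p))) p := by
  have hD : 1 + a p ^ 2 + b p ^ 2 ≠ 0 := by positivity
  have hE := (Real.exp_pos (u p)).ne'
  have da := R.da p hp
  have db := R.db p hp
  have dD := (HasPartials.const (p := p) (2 : ℝ)).div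
    (((HasPartials.const (p := p) (1 : ℝ)).add (da.mul da)).add (db.mul db))
    (by rw [← sq, ← sq]; exact hD)
  have h := (F.dn p hp).add (dD.smul (((F.dn p hp).neg.add (da.smul (F.dt₂ p hp))).add
    (db.smul (F.dt₃ p hp))))
  have he : reflectedNormal n t₂ t₃ a b = fun q => n q +
      (2 / (1 + a q * a q + b q * b q)) • (-n q + a q • t₂ q + b q • t₃ q) := by
    funext q; rw [reflectedNormal, sq, sq]
  rw [he]
  refine h.congr_partials ?_ ?_ <;>
  · simp only [← sq]
    generalize Real.exp (u p) = E at *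
    match_scalars <;> field_simp <;> ring

/-- The frame at the second envelope: the reflection of `n, t₂, t₃`. -/
theorem orthonormal_reflected (F : PrincipalFrame U f n t₂ t₃ u h₁ h₂) (hp : p ∈ U) :
    inner ℝ (reflectedNormal n t₂ t₃ a b p) (reflectedNormal n t₂ t₃ a b p) = (1 : ℝ) ∧
    inner ℝ (t₂ p - a p • (reflectedNormal n t₂ t₃ a b p - n p))
      (t₂ p - a p • (reflectedNormal n t₂ t₃ a b p - n p)) = (1 : ℝ) ∧
    inner ℝ (t₃ p - b p • (reflectedNormal n t₂ t₃ a b p - n p))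
      (t₃ p - b p • (reflectedNormal n t₂ t₃ a b p - n p)) = (1 : ℝ) ∧
    inner ℝ (t₂ p - a p • (reflectedNormal n t₂ t₃ a b p - n p))
      (t₃ p - b p • (reflectedNormal n t₂ t₃ a b p - n p)) = (0 : ℝ) := by
  have hD : 1 + a p ^ 2 + b p ^ 2 ≠ 0 := by positivity
  refine ⟨?_, ?_, ?_, ?_⟩ <;>
  · simp only [reflectedNormal, inner_add_left, inner_add_right, inner_sub_left, inner_sub_right,
      real_inner_smul_left, real_inner_smul_right, inner_neg_left, inner_neg_right, F.n_n p hp,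
      F.t₂_t₂ p hp, F.t₃_t₃ p hp, F.n_t₂ p hp, F.n_t₃ p hp, F.t₂_t₃ p hp, F.t₂_n hp, F.t₃_n hp,
      F.t₃_t₂ hp]
    field_simp
    ring

theorem spacelike (R : RiccatiSolution U u h₁ h₂ m a b ρ)
    (F : PrincipalFrame U f n t₂ t₃ u h₁ h₂) :
    IsSpacelikeImmersion U (tangentSpheres f n ρ) := by
  refine ⟨(F.smooth_f.sub (R.smooth_ρ.smul F.smooth_n)).prodMk R.smooth_ρ, fun p hp X hX => ?_⟩
  rw [(F.hasPartials_tangentSpheres hp (R.dρ p hp)).fderiv_apply]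
  have h1 := R.ne₁ p hp
  have h2 := R.ne₂ p hp
  have key : lorentz (X.1 • (h₁ p - ρ p * Real.exp (u p)) • (t₂ p + a p • n p, -a p) +
      X.2 • (h₂ p - ρ p * Real.exp (u p)) • (t₃ p + b p • n p, -b p))
      (X.1 • (h₁ p - ρ p * Real.exp (u p)) • (t₂ p + a p • n p, -a p) +
      X.2 • (h₂ p - ρ p * Real.exp (u p)) • (t₃ p + b p • n p, -b p)) =
      (X.1 * (h₁ p - ρ p * Real.exp (u p))) ^ 2 + (X.2 * (h₂ p - ρ p * Real.exp (u p))) ^ 2 := by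
    simp only [lorentz, Prod.fst_add, Prod.snd_add, Prod.smul_fst, Prod.smul_snd, inner_add_left,
      inner_add_right, real_inner_smul_left, real_inner_smul_right, F.n_n p hp,
      F.t₂_t₂ p hp, F.t₃_t₃ p hp, F.n_t₂ p hp, F.n_t₃ p hp, F.t₂_t₃ p hp, F.t₂_n hp, F.t₃_n hp,
      F.t₃_t₂ hp, smul_eq_mul]
    ring
  rw [key]
  rcases eq_or_ne X.1 0 with h | h
  · have : X.2 ≠ 0 := fun h' => hX (Prod.ext h h')
    positivity
  · positivity

/-- Differentiating the equation of the complex twice forces its vector `(c, k)` to vanish; `m ≠ 0`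
is the decisive input. -/
theorem not_inFixedSphereComplex (R : RiccatiSolution U u h₁ h₂ m a b ρ)
    (F : PrincipalFrame U f n t₂ t₃ u h₁ h₂) (hU : IsOpen U) (hne : U.Nonempty) :
    ¬ InFixedSphereComplex U (tangentSpheres f n ρ) := by
  rintro ⟨⟨c, k⟩, l, hC, hl⟩
  -- First derivative: `(c, k)` is Lorentz-orthogonal to both tangent vectors of the congruence,
  -- after cancelling the nonzero factors.
  have hz (p) (hp : p ∈ U) : inner ℝ (t₂ p) c + a p * (inner ℝ (n p) c + k) = 0 ∧
      inner ℝ (t₃ p) c + b p * (inner ℝ (n p) c + k) = 0 := by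
    have dρ := R.dρ p hp
    have h := (((F.df p hp).sub (dρ.smul (F.dn p hp))).inner (HasPartials.const c)).sub
      (dρ.mul (HasPartials.const k))
    obtain ⟨e₁, e₂⟩ := h.unique ((HasPartials.const l).congr_of_eqOn hU hp hl)
    simp only [inner_zero_right, inner_sub_left, inner_add_left, real_inner_smul_left] at e₁ e₂
    exact ⟨mul_left_cancel₀ (R.ne₁ p hp) (by linear_combination e₁),
      mul_left_cancel₀ (R.ne₂ p hp) (by linear_combination e₂)⟩
  obtain ⟨p, hp⟩ := hne
  have hE := (Real.exp_pos (u p)).ne'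
  have dc := HasPartials.const (p := p) c
  have dN := ((F.dn p hp).inner dc).add (HasPartials.const k)
  have d₂ := (((F.dt₂ p hp).inner dc).add ((R.da p hp).mul dN)).unique
    ((HasPartials.const 0).congr_of_eqOn hU hp fun q hq => (hz q hq).1)
  have d₃ := (((F.dt₃ p hp).inner dc).add ((R.db p hp).mul dN)).unique
    ((HasPartials.const 0).congr_of_eqOn hU hp fun q hq => (hz q hq).2)
  simp only [inner_zero_right, inner_sub_left, real_inner_smul_left] at d₂ d₃
  obtain ⟨z₂, z₃⟩ := hz p hp
  -- Second derivative: subtracting the `x`-derivative of the first relation from the `y`-derivative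
  -- of the second cancels everything, modulo the relations themselves, except the `m` terms, which
  -- add up to `m / e^u`.
  have hN : inner ℝ (n p) c + k = 0 := by
    have : m / Real.exp (u p) * (inner ℝ (n p) c + k) = 0 := by
      have e₂ := d₂.1
      have e₃ := d₃.2
      have e : m / Real.exp (u p) = m / (2 * Real.exp (u p)) + m / (2 * Real.exp (u p)) := by
        field_simp; norm_num
      rw [e]
      linear_combination e₃ - e₂ - z₃ * (ddy u p + Real.exp (u p) * b p)
        + z₂ * (ddx u p + Real.exp (u p) * a p)
    exact (mul_eq_zero.mp this).resolve_left (div_ne_zero R.m_ne hE)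
  have hT₂ : inner ℝ (t₂ p) c = (0 : ℝ) := by linear_combination z₂ - a p * hN
  have hT₃ : inner ℝ (t₃ p) c = (0 : ℝ) := by linear_combination z₃ - b p * hN
  have hn : inner ℝ (n p) c = (0 : ℝ) := by
    have e₂ := d₂.1
    rw [hT₂, hT₃, hN] at e₂
    exact mul_left_cancel₀ hE (by linear_combination -e₂)
  have hk : k = 0 := by linear_combination hN - hn
  have hc : c = 0 := eq_of_inner_eq (F.n_n p hp) (F.t₂_t₂ p hp) (F.t₃_t₃ p hp) (F.n_t₂ p hp)
    (F.n_t₃ p hp) (F.t₂_t₃ p hp) (by rw [real_inner_comm, hn, inner_zero_left])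
    (by rw [real_inner_comm, hT₂, inner_zero_left]) (by rw [real_inner_comm, hT₃, inner_zero_left])
  exact hC (by rw [hc, hk]; rfl)

/-- A solution of the Riccati system yields a Bianchi-Darboux pair. -/
theorem isBianchiDarbouxPair (R : RiccatiSolution U u h₁ h₂ m a b ρ)
    (F : PrincipalFrame U f n t₂ t₃ u h₁ h₂) (hU : IsOpen U) (hne : U.Nonempty)
    (hL : IsLIsothermicLegendre U f n) {f' : Plane → E3}
    (hf' : ∀ p ∈ U, f' p = f p + ρ p • (reflectedNormal n t₂ t₃ a b p - n p)) :
    IsBianchiDarbouxPair U f n f' (reflectedNormal n t₂ t₃ a b) := by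
  have hD (p) : 1 + a p ^ 2 + b p ^ 2 ≠ 0 := by positivity
  set κ : Plane → ℝ := fun p => m / (Real.exp (u p) * (1 + a p ^ 2 + b p ^ 2)) with hκ
  have κ_ne (p) : κ p ≠ 0 :=
    div_ne_zero R.m_ne (mul_ne_zero (Real.exp_pos _).ne' (hD p))
  set τ₂ : Plane → E3 := fun p => t₂ p - a p • (reflectedNormal n t₂ t₃ a b p - n p) with hτ₂
  set τ₃ : Plane → E3 := fun p => t₃ p - b p • (reflectedNormal n t₂ t₃ a b p - n p) with hτ₃
  have dN (p) (hp : p ∈ U) :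
      HasPartials (reflectedNormal n t₂ t₃ a b) ((-κ p) • τ₂ p) (κ p • τ₃ p) p :=
    R.hasPartials_reflectedNormal F hp
  -- Differentiating `f + ρ (N - n)` gives `f'_x = (h₁ - ρ e^u) τ₂ + ρ N_x`, and similarly in `y`.
  -- Since `κ ≠ 0`, these are multiples of `N_x` and `N_y`; the factors are the ones needed for
  -- curvature directions.
  have df' (p) (hp : p ∈ U) : HasPartials f'
      ((ρ p - (h₁ p - ρ p * Real.exp (u p)) / κ p) • (-κ p) • τ₂ p)
      ((ρ p + (h₂ p - ρ p * Real.exp (u p)) / κ p) • κ p • τ₃ p) p := by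
    refine (((F.df p hp).add ((R.dρ p hp).smul ((dN p hp).sub (F.dn p hp)))).congr_of_eqOn hU hp
      hf').congr_partials ?_ ?_
    · rw [smul_smul _ (-κ p), show (ρ p - (h₁ p - ρ p * Real.exp (u p)) / κ p) * -κ p =
        (h₁ p - ρ p * Real.exp (u p)) - ρ p * κ p by field_simp [κ_ne p]; ring]
      simp only [hτ₂]
      module
    · rw [smul_smul _ (κ p), show (ρ p + (h₂ p - ρ p * Real.exp (u p)) / κ p) * κ p =
        (h₂ p - ρ p * Real.exp (u p)) + ρ p * κ p by field_simp [κ_ne p]; ring]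
      simp only [hτ₃]
      module
  have sN : ContDiffOn ℝ ∞ (reflectedNormal n t₂ t₃ a b) U :=
    F.smooth_n.add ((contDiffOn_const.div ((contDiffOn_const.add (R.smooth_a.pow 2)).add
      (R.smooth_b.pow 2)) fun p _ => hD p).smul ((F.smooth_n.neg.add
        (R.smooth_a.smul F.smooth_t₂)).add (R.smooth_b.smul F.smooth_t₃)))
  have sf' : ContDiffOn ℝ ∞ f' U :=
    (F.smooth_f.add (R.smooth_ρ.smul (sN.sub F.smooth_n))).congr hf'
  have ho (p) (hp : p ∈ U) := orthonormal_reflected (a := a) (b := b) F hp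
  have hL' : IsLIsothermicLegendre U f' (reflectedNormal n t₂ t₃ a b) :=
    IsLIsothermicLegendre.of_hasPartials (k := fun p => -κ p) (l := κ) hU sf' sN
      (fun p hp => (ho p hp).1) (fun p hp => (ho p hp).2.1) (fun p hp => (ho p hp).2.2.1)
      (fun p hp => (ho p hp).2.2.2) (fun p _ => neg_ne_zero.mpr (κ_ne p))
      (fun p _ => (neg_sq _).symm) dN df'
  refine ⟨hL, hL', tangentSpheres f n ρ,
    ⟨R.spacelike F, fun p _ => ⟨ρ p, rfl⟩, fun p hp => ⟨ρ p, ?_⟩, fun p hp h => ?_,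
      fun p hp => ⟨(1, 0), (0, 1), ?_, ⟨h₁ p / Real.exp (u p), ?_⟩,
        ⟨ρ p - (h₁ p - ρ p * Real.exp (u p)) / κ p, ?_⟩, ⟨h₂ p / Real.exp (u p), ?_⟩,
        ⟨ρ p + (h₂ p - ρ p * Real.exp (u p)) / κ p, ?_⟩⟩,
      fun p hp => ⟨κ p ^ 2 / Real.exp (u p) ^ 2, ?_, fun X Y => ?_⟩⟩,
    R.not_inFixedSphereComplex F hU hne⟩
  · rw [tangentSpheres, hf' p hp]
    refine Prod.ext ?_ rfl
    simp only
    module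
  -- `N · n = 1 - D` with `D ≠ 0`, so the normals are distinct.
  · have := congrArg (fun w => inner ℝ w (n p)) h
    simp only [reflectedNormal, inner_add_left, real_inner_smul_left, inner_neg_left, F.n_n p hp,
      F.t₂_n hp, F.t₃_n hp] at this
    have h2 : (2 : ℝ) / (1 + a p ^ 2 + b p ^ 2) ≠ 0 := div_ne_zero two_ne_zero (hD p)
    exact h2 (by linarith)
  · rw [LinearIndependent.pair_iff]
    intro s t hst
    simpa using hst
  · change ddx f p = _ • ddx n p
    rw [(F.df p hp).ddx_eq, (F.dn p hp).ddx_eq, smul_smul, div_mul_cancel₀ _ (Real.exp_pos _).ne']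
  · change ddx f' p = _ • ddx _ p
    rw [(df' p hp).ddx_eq, (dN p hp).ddx_eq]
  · change ddy f p = _ • ddy n p
    rw [(F.df p hp).ddy_eq, (F.dn p hp).ddy_eq, smul_smul, div_mul_cancel₀ _ (Real.exp_pos _).ne']
  · change ddy f' p = _ • ddy _ p
    rw [(df' p hp).ddy_eq, (dN p hp).ddy_eq]
  · have := κ_ne p
    positivity
  · obtain ⟨-, o₂, o₃, o₂₃⟩ := ho p hp
    have o₃₂ := o₂₃
    rw [real_inner_comm] at o₃₂
    change inner ℝ (τ₂ p) (τ₂ p) = (1 : ℝ) at o₂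
    change inner ℝ (τ₃ p) (τ₃ p) = (1 : ℝ) at o₃
    change inner ℝ (τ₂ p) (τ₃ p) = (0 : ℝ) at o₂₃
    change inner ℝ (τ₃ p) (τ₂ p) = (0 : ℝ) at o₃₂
    have hE := (Real.exp_pos (u p)).ne'
    simp only [thirdForm, (dN p hp).fderiv_apply, (F.dn p hp).fderiv_apply, inner_add_left,
      inner_add_right, real_inner_smul_left, real_inner_smul_right, o₂, o₃, o₂₃, o₃₂,
      F.t₂_t₂ p hp, F.t₃_t₃ p hp, F.t₂_t₃ p hp, F.t₃_t₂ hp]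
    field_simp
    ring

end RiccatiSolution

/-! ### The second envelope of a Darboux congruence -/

/-- The reflection of the tangent vector `t`, where `a = t · N / (1 - n · N)`, in the hyperplane
that interchanges `n` and `N`. -/
def reflectedTangent (t n N : Plane → E3) (a : Plane → ℝ) (p : Plane) : E3 :=
  t p - a p • (N p - n p)

/-- A second unit normal `N`, with `D = 1 - n · N`, whose derivatives are multiples of the
reflections of `t₂` and `t₃`. -/
structure ReflectedFrame (U : Set Plane) (n t₂ t₃ N : Plane → E3) (D a b κ₁ κ₂ : Plane → ℝ) :
    Prop where
  smooth_κ₁ : ContDiffOn ℝ ∞ κ₁ U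
  smooth_κ₂ : ContDiffOn ℝ ∞ κ₂ U
  D_ne : ∀ p ∈ U, D p ≠ 0
  N_N : ∀ p ∈ U, inner ℝ (N p) (N p) = (1 : ℝ)
  n_N : ∀ p ∈ U, inner ℝ (n p) (N p) = 1 - D p
  t₂_N : ∀ p ∈ U, inner ℝ (t₂ p) (N p) = a p * D p
  t₃_N : ∀ p ∈ U, inner ℝ (t₃ p) (N p) = b p * D p
  D_mul : ∀ p ∈ U, D p * (1 + a p ^ 2 + b p ^ 2) = 2
  dN : ∀ p ∈ U, HasPartials N (κ₁ p • reflectedTangent t₂ n N a p)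
    (κ₂ p • reflectedTangent t₃ n N b p) p
  κ_sq : ∀ p ∈ U, κ₁ p ^ 2 = κ₂ p ^ 2
  κ₂_ne : ∀ p ∈ U, κ₂ p ≠ 0

/-! ### Structure equations of the second Gauss map and the two sign cases. -/

namespace ReflectedFrame

variable {U : Set Plane} {f n t₂ t₃ N : Plane → E3} {u h₁ h₂ D a b κ₁ κ₂ : Plane → ℝ} {p : Plane}

/-- All entries reduce to the products of `N` with `n, t₂, t₃`; in particular `‖N - n‖² = 2 D` makes
the reflected frame orthonormal. -/
theorem inner_table (G : ReflectedFrame U n t₂ t₃ N D a b κ₁ κ₂)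
    (F : PrincipalFrame U f n t₂ t₃ u h₁ h₂) (hp : p ∈ U) :
    (inner ℝ (n p) (reflectedTangent t₂ n N a p) = a p * D p ∧
      inner ℝ (t₂ p) (reflectedTangent t₂ n N a p) = 1 - a p ^ 2 * D p ∧
      inner ℝ (t₃ p) (reflectedTangent t₂ n N a p) = - a p * b p * D p ∧
      inner ℝ (N p) (reflectedTangent t₂ n N a p) = (0 : ℝ)) ∧
    (inner ℝ (n p) (reflectedTangent t₃ n N b p) = b p * D p ∧
      inner ℝ (t₂ p) (reflectedTangent t₃ n N b p) = - a p * b p * D p ∧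
      inner ℝ (t₃ p) (reflectedTangent t₃ n N b p) = 1 - b p ^ 2 * D p ∧
      inner ℝ (N p) (reflectedTangent t₃ n N b p) = (0 : ℝ)) ∧
    inner ℝ (reflectedTangent t₂ n N a p) (reflectedTangent t₂ n N a p) = (1 : ℝ) ∧
    inner ℝ (reflectedTangent t₃ n N b p) (reflectedTangent t₃ n N b p) = (1 : ℝ) ∧
    inner ℝ (reflectedTangent t₂ n N a p) (reflectedTangent t₃ n N b p) = (0 : ℝ) ∧
    inner ℝ (reflectedTangent t₃ n N b p) (reflectedTangent t₂ n N a p) = (0 : ℝ) := by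
  have q₁ : inner ℝ (N p) (n p) = 1 - D p := by rw [real_inner_comm, G.n_N p hp]
  have q₂ : inner ℝ (N p) (t₂ p) = a p * D p := by rw [real_inner_comm, G.t₂_N p hp]
  have q₃ : inner ℝ (N p) (t₃ p) = b p * D p := by rw [real_inner_comm, G.t₃_N p hp]
  refine ⟨⟨?_, ?_, ?_, ?_⟩, ⟨?_, ?_, ?_, ?_⟩, ?_, ?_, ?_, ?_⟩ <;>
  · simp only [reflectedTangent, inner_sub_left, inner_sub_right, real_inner_smul_left,
      real_inner_smul_right, F.n_n p hp, F.t₂_t₂ p hp, F.t₃_t₃ p hp, F.n_t₂ p hp, F.n_t₃ p hp,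
      F.t₂_t₃ p hp, F.t₂_n hp, F.t₃_n hp, F.t₃_t₂ hp, q₁, q₂, q₃, G.n_N p hp, G.t₂_N p hp,
      G.t₃_N p hp, G.N_N p hp]
    ring

theorem hasPartials_D (G : ReflectedFrame U n t₂ t₃ N D a b κ₁ κ₂)
    (F : PrincipalFrame U f n t₂ t₃ u h₁ h₂) (hU : IsOpen U) (hp : p ∈ U) :
    HasPartials D (-(a p * D p * (Real.exp (u p) + κ₁ p)))
      (-(b p * D p * (Real.exp (u p) + κ₂ p))) p := by
  obtain ⟨⟨i₁, -⟩, ⟨i₂, -⟩, -⟩ := G.inner_table F hp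
  refine (((HasPartials.const (1 : ℝ)).sub ((F.dn p hp).inner (G.dN p hp))).congr_of_eqOn hU hp
    (g' := D) fun q hq => by rw [G.n_N q hq]; ring).congr_partials ?_ ?_
  · rw [real_inner_smul_left, real_inner_smul_right, i₁, G.t₂_N p hp]; ring
  · rw [real_inner_smul_left, real_inner_smul_right, i₂, G.t₃_N p hp]; ring

/-- Obtained from `a = (t₂ · N) / D`. The `y`-derivative is already that of the Riccati system,
whatever `κ₁, κ₂` are; only the `x`-derivative still contains `κ₁`. -/
theorem hasPartials_a (G : ReflectedFrame U n t₂ t₃ N D a b κ₁ κ₂)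
    (F : PrincipalFrame U f n t₂ t₃ u h₁ h₂) (hU : IsOpen U) (hp : p ∈ U) :
    HasPartials a
      (Real.exp (u p) * a p ^ 2 + (κ₁ p - Real.exp (u p)) / D p + Real.exp (u p) - ddy u p * b p)
      (ddx u p * b p + Real.exp (u p) * a p * b p) p := by
  obtain ⟨⟨i₁, i₂, i₃, i₄⟩, ⟨j₁, j₂, j₃, j₄⟩, -⟩ := G.inner_table F hp
  have hD := G.D_ne p hp
  refine ((((F.dt₂ p hp).inner (G.dN p hp)).div (G.hasPartials_D F hU hp) hD).congr_of_eqOn hU hp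
    (g' := a) fun q hq => by rw [G.t₂_N q hq, mul_div_cancel_right₀ _ (G.D_ne q hq)]).congr_partials
    ?_ ?_ <;>
  · simp only [inner_sub_left, real_inner_smul_left, real_inner_smul_right, G.n_N p hp,
      G.t₂_N p hp, G.t₃_N p hp, i₂, j₂]
    field_simp
    ring

theorem hasPartials_b (G : ReflectedFrame U n t₂ t₃ N D a b κ₁ κ₂)
    (F : PrincipalFrame U f n t₂ t₃ u h₁ h₂) (hU : IsOpen U) (hp : p ∈ U) :
    HasPartials b (ddy u p * a p + Real.exp (u p) * a p * b p)
      (Real.exp (u p) * b p ^ 2 + (κ₂ p - Real.exp (u p)) / D p + Real.exp (u p) - ddx u p * a p)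
      p := by
  obtain ⟨⟨i₁, i₂, i₃, i₄⟩, ⟨j₁, j₂, j₃, j₄⟩, -⟩ := G.inner_table F hp
  have hD := G.D_ne p hp
  refine ((((F.dt₃ p hp).inner (G.dN p hp)).div (G.hasPartials_D F hU hp) hD).congr_of_eqOn hU hp
    (g' := b) fun q hq => by rw [G.t₃_N q hq, mul_div_cancel_right₀ _ (G.D_ne q hq)]).congr_partials
    ?_ ?_ <;>
  · simp only [inner_sub_left, real_inner_smul_left, real_inner_smul_right, G.n_N p hp,
      G.t₂_N p hp, G.t₃_N p hp, i₃, j₃]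
    field_simp
    ring

/-- The Codazzi equations of the second Gauss map. -/
theorem codazzi (G : ReflectedFrame U n t₂ t₃ N D a b κ₁ κ₂)
    (F : PrincipalFrame U f n t₂ t₃ u h₁ h₂) (hU : IsOpen U) (hp : p ∈ U) :
    ddx κ₂ p = κ₁ p * (ddx u p + a p * (Real.exp (u p) - κ₂ p)) ∧
      ddy κ₁ p = κ₂ p * (ddy u p + b p * (Real.exp (u p) - κ₁ p)) := by
  obtain ⟨⟨i₁, i₂, i₃, i₄⟩, ⟨j₁, j₂, j₃, j₄⟩, k₁, k₂, k₃, k₄⟩ := G.inner_table F hp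
  have d₁ := hasPartials_of_contDiffOn hU G.smooth_κ₁ hp
  have d₂ := hasPartials_of_contDiffOn hU G.smooth_κ₂ hp
  have dτ₂ : HasPartials (reflectedTangent t₂ n N a) _ _ p :=
    (F.dt₂ p hp).sub ((G.hasPartials_a F hU hp).smul ((G.dN p hp).sub (F.dn p hp)))
  have dτ₃ : HasPartials (reflectedTangent t₃ n N b) _ _ p :=
    (F.dt₃ p hp).sub ((G.hasPartials_b F hU hp).smul ((G.dN p hp).sub (F.dn p hp)))
  -- `N_xy = N_yx`; the components along `τ₂` and `τ₃` are the two equations.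
  have hs := HasPartials.symm hU hp G.dN (d₁.smul dτ₂) (d₂.smul dτ₃)
  have e₂ := congrArg (fun w => inner ℝ w (reflectedTangent t₂ n N a p)) hs
  have e₃ := congrArg (fun w => inner ℝ w (reflectedTangent t₃ n N b p)) hs
  simp only [inner_add_left, inner_sub_left, real_inner_smul_left, i₁, i₂, i₃, i₄, j₁, j₂, j₃, j₄,
    k₁, k₂, k₃, k₄] at e₂ e₃
  exact ⟨by linear_combination -e₃, by linear_combination e₂⟩

/-- If the correspondence of the Gauss maps preserves the orientation of the reflected frame, the
spheres belong to a fixed sphere complex. -/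
theorem inFixedSphereComplex (G : ReflectedFrame U n t₂ t₃ N D a b κ₁ κ₂)
    (F : PrincipalFrame U f n t₂ t₃ u h₁ h₂) (hU : IsOpen U) (hUc : IsConnected U)
    (hκ : ∀ p ∈ U, κ₁ p = κ₂ p) {ρ : Plane → ℝ}
    (hρ : ∀ p ∈ U, HasPartials ρ (-(h₁ p - ρ p * Real.exp (u p)) * a p)
      (-(h₂ p - ρ p * Real.exp (u p)) * b p) p) :
    InFixedSphereComplex U (tangentSpheres f n ρ) := by
  -- An integrating factor: `d log β = κ₂ (a dx + b dy)`, solved explicitly by the Codazzi equations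
  -- and the derivative of `D`. `Real.log` of a negative `κ₂` is `log |κ₂|`, which has the same
  -- derivative formula.
  set β : Plane → ℝ := fun p => Real.exp ((u p - Real.log (κ₂ p) - Real.log (D p)) / 2) with hβ
  have dκ (p) (hp : p ∈ U) : HasPartials κ₂
      (κ₂ p * (ddx u p + a p * (Real.exp (u p) - κ₂ p)))
      (κ₂ p * (ddy u p + b p * (Real.exp (u p) - κ₂ p))) p := by
    have d₁ := hasPartials_of_contDiffOn hU G.smooth_κ₁ hp
    have d₂ := hasPartials_of_contDiffOn hU G.smooth_κ₂ hp
    obtain ⟨c₁, c₂⟩ := G.codazzi F hU hp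
    have e := (d₁.unique (d₂.congr_of_eqOn hU hp hκ)).2
    exact d₂.congr_partials (by rw [c₁, hκ p hp]) (by rw [← e, c₂, hκ p hp])
  have dβ (p) (hp : p ∈ U) : HasPartials β (β p * (κ₂ p * a p)) (β p * (κ₂ p * b p)) p := by
    have hD := G.D_ne p hp
    have hk := G.κ₂_ne p hp
    have h := (((F.hasPartials_u hU hp).sub ((dκ p hp).log hk)).sub
      ((G.hasPartials_D F hU hp).log hD)).div (HasPartials.const (2 : ℝ)) two_ne_zero
    refine h.exp.congr_partials ?_ ?_ <;>
    · try rw [hκ p hp]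
      simp only [hβ]
      congr 1
      field_simp
      ring
  have dE (p) (hp : p ∈ U) := (F.hasPartials_u hU hp).exp
  have dq (p) (hp : p ∈ U) : HasPartials (fun p => κ₂ p / Real.exp (u p))
      (κ₂ p / Real.exp (u p) * (a p * (Real.exp (u p) - κ₂ p)))
      (κ₂ p / Real.exp (u p) * (b p * (Real.exp (u p) - κ₂ p))) p := by
    have hE := (Real.exp_pos (u p)).ne'
    exact ((dκ p hp).div (dE p hp) hE).congr_partials (by field_simp; ring) (by field_simp; ring)
  -- With `q = κ₂ / e^u` this is `β ((N, -1) - q (n, -1))`, a combination of the null directions of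
  -- the two contact lines, both orthogonal to `dS`. The choice of `q` removes `τ₂, τ₃` from the
  -- derivative of `N - q n`, leaving multiples of `N` and `n`; `β` then makes the derivative
  -- vanish.
  set C : Plane → Mink := fun p => (β p • (N p - (κ₂ p / Real.exp (u p)) • n p),
    β p * (κ₂ p / Real.exp (u p) - 1)) with hC
  have dC (p) (hp : p ∈ U) : HasPartials C 0 0 p := by
    have hE := (Real.exp_pos (u p)).ne'
    refine (((dβ p hp).smul ((G.dN p hp).sub ((dq p hp).smul (F.dn p hp)))).prodMk
      ((dβ p hp).mul ((dq p hp).sub (HasPartials.const 1)))).congr_partials ?_ ?_ <;>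
    · refine Prod.ext ?_ ?_
      · simp only [hκ p hp, reflectedTangent, Prod.fst_zero]
        generalize Real.exp (u p) = E at *
        match_scalars <;> field_simp <;> ring
      · simp only [Prod.snd_zero]
        field_simp
        ring
  obtain ⟨p₀, hp₀⟩ := hUc.nonempty
  have hCc (p) (hp : p ∈ U) : C p = C p₀ := eq_of_hasPartials_zero hU hUc.isPreconnected dC hp hp₀
  -- If `C p₀ = 0`, the radius component gives `q = 1`, and then `N = n`, against `D ≠ 0`. Constancy
  -- of the product follows from `C` being orthogonal to `dS`.
  refine ⟨C p₀, lorentz (tangentSpheres f n ρ p₀) (C p₀), fun h0 => ?_, fun p hp => ?_⟩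
  · have hβ0 : β p₀ ≠ 0 := (Real.exp_pos _).ne'
    have h1 : N p₀ - (κ₂ p₀ / Real.exp (u p₀)) • n p₀ = 0 :=
      (smul_eq_zero.mp (congrArg Prod.fst h0)).resolve_left hβ0
    have h2 : κ₂ p₀ / Real.exp (u p₀) - 1 = 0 :=
      (mul_eq_zero.mp (congrArg Prod.snd h0)).resolve_left hβ0
    rw [sub_eq_zero.mp h2, one_smul, sub_eq_zero] at h1
    have := G.n_N p₀ hp₀
    rw [h1, F.n_n p₀ hp₀] at this
    exact G.D_ne p₀ hp₀ (by linarith)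
  · refine eq_of_hasPartials_zero (g := fun p => lorentz (tangentSpheres f n ρ p) (C p₀)) hU
      hUc.isPreconnected (fun q hq => ?_) hp hp₀
    have h := (((F.df q hq).sub ((hρ q hq).smul (F.dn q hq))).inner
      (HasPartials.const (C p₀).1)).sub ((hρ q hq).mul (HasPartials.const (C p₀).2))
    refine HasPartials.congr_partials h ?_ ?_ <;>
    · rw [← hCc q hq]
      simp only [hC, inner_sub_left, inner_sub_right, inner_add_left, real_inner_smul_left,
        real_inner_smul_right, inner_zero_right, F.n_n q hq, F.t₂_n hq, F.t₃_n hq, G.n_N q hq,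
        G.t₂_N q hq, G.t₃_N q hq]
      ring

/-- If the correspondence of the Gauss maps reverses the orientation of the reflected frame,
`2 κ₂ e^u / D` is a constant, and `a`, `b` solve the Riccati system for this constant. -/
theorem exists_riccatiSolution (G : ReflectedFrame U n t₂ t₃ N D a b κ₁ κ₂)
    (F : PrincipalFrame U f n t₂ t₃ u h₁ h₂) (hU : IsOpen U) (hUc : IsConnected U)
    (hκ : ∀ p ∈ U, κ₁ p = -κ₂ p) (sN : ContDiffOn ℝ ∞ N U) {ρ : Plane → ℝ}
    (sρ : ContDiffOn ℝ ∞ ρ U)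
    (hρ : ∀ p ∈ U, HasPartials ρ (-(h₁ p - ρ p * Real.exp (u p)) * a p)
      (-(h₂ p - ρ p * Real.exp (u p)) * b p) p)
    (ne₁ : ∀ p ∈ U, h₁ p - ρ p * Real.exp (u p) ≠ 0)
    (ne₂ : ∀ p ∈ U, h₂ p - ρ p * Real.exp (u p) ≠ 0) :
    ∃ m, RiccatiSolution U u h₁ h₂ m a b ρ := by
  have dκ (p) (hp : p ∈ U) : HasPartials κ₂
      (-κ₂ p * (ddx u p + a p * (Real.exp (u p) - κ₂ p)))
      (-κ₂ p * (ddy u p + b p * (Real.exp (u p) + κ₂ p))) p := by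
    have d₁ := hasPartials_of_contDiffOn hU G.smooth_κ₁ hp
    have d₂ := hasPartials_of_contDiffOn hU G.smooth_κ₂ hp
    obtain ⟨c₁, c₂⟩ := G.codazzi F hU hp
    have e := (d₁.unique (d₂.neg.congr_of_eqOn hU hp hκ)).2
    rw [c₂, hκ p hp] at e
    exact d₂.congr_partials (by rw [c₁, hκ p hp]) (by linear_combination e)
  -- The expression is found by solving `κ = m D / (2 e^u)` for `m`; the Codazzi equations and the
  -- derivatives of `u` and `D` cancel.
  have dM (p) (hp : p ∈ U) : HasPartials (fun p => 2 * (κ₂ p * Real.exp (u p)) / D p) 0 0 p := by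
    have hD := G.D_ne p hp
    refine (((HasPartials.const (2 : ℝ)).mul ((dκ p hp).mul (F.hasPartials_u hU hp).exp)).div
      (G.hasPartials_D F hU hp) hD).congr_partials ?_ ?_ <;>
    · try rw [hκ p hp]
      field_simp
      ring
  obtain ⟨p₀, hp₀⟩ := hUc.nonempty
  set m : ℝ := 2 * (κ₂ p₀ * Real.exp (u p₀)) / D p₀ with hm
  have hM (p) (hp : p ∈ U) : 2 * (κ₂ p * Real.exp (u p)) / D p = m :=
    eq_of_hasPartials_zero hU hUc.isPreconnected dM hp hp₀
  have sD : ContDiffOn ℝ ∞ D U :=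
    (contDiffOn_const (c := (1 : ℝ)).sub (F.smooth_n.inner ℝ sN)).congr
      fun q hq => by rw [G.n_N q hq]; ring
  refine ⟨m, div_ne_zero (mul_ne_zero two_ne_zero
    (mul_ne_zero (G.κ₂_ne p₀ hp₀) (Real.exp_pos _).ne')) (G.D_ne p₀ hp₀), ?_, ?_, sρ,
    fun p hp => ?_, fun p hp => ?_, hρ, ne₁, ne₂⟩
  · exact ((F.smooth_t₂.inner ℝ sN).div sD G.D_ne).congr
      fun q hq => by
        rw [Pi.div_apply, G.t₂_N q hq, mul_div_cancel_right₀ _ (G.D_ne q hq)]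
  · exact ((F.smooth_t₃.inner ℝ sN).div sD G.D_ne).congr
      fun q hq => by
        rw [Pi.div_apply, G.t₃_N q hq, mul_div_cancel_right₀ _ (G.D_ne q hq)]
  -- Here `κ₂ / D = m / (2 e^u)`, and `D (1 + a² + b²) = 2` replaces `1 / D` by `(1 + a² + b²) / 2`.
  · refine (G.hasPartials_a F hU hp).congr_partials ?_ rfl
    have hD := G.D_ne p hp
    have hE := (Real.exp_pos (u p)).ne'
    rw [hκ p hp, ← hM p hp]
    field_simp
    linear_combination Real.exp (u p) * G.D_mul p hp
  · refine (G.hasPartials_b F hU hp).congr_partials rfl ?_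
    have hD := G.D_ne p hp
    have hE := (Real.exp_pos (u p)).ne'
    rw [← hM p hp]
    field_simp
    linear_combination Real.exp (u p) * G.D_mul p hp

end ReflectedFrame

/-! ### From a Darboux congruence to the Riccati system. -/

namespace PrincipalFrame

variable {U : Set Plane} {f n t₂ t₃ : Plane → E3} {u h₁ h₂ : Plane → ℝ}

/-- A nondegenerate Darboux congruence of spheres tangent to `f`, one of whose envelopes is
`L`-isothermic for the same polarization, comes from a solution of the Riccati system. -/
theorem exists_riccatiSolution (F : PrincipalFrame U f n t₂ t₃ u h₁ h₂) (hU : IsOpen U)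
    (hUc : IsConnected U) {f' N : Plane → E3} {S : Plane → Mink}
    (hL' : IsLIsothermicLegendre U f' N) (hS : IsDarbouxCongruence U S f n f' N)
    (hnd : ¬ InFixedSphereComplex U S) :
    ∃ (m : ℝ) (a b : Plane → ℝ), RiccatiSolution U u h₁ h₂ m a b (fun p => (S p).2) ∧
      ∀ p ∈ U, f' p = f p + (S p).2 • (reflectedNormal n t₂ t₃ a b p - n p) := by
  set ρ : Plane → ℝ := fun p => (S p).2 with hρdef
  set D : Plane → ℝ := fun p => 1 - inner ℝ (n p) (N p) with hDdef
  set a : Plane → ℝ := fun p => inner ℝ (t₂ p) (N p) / D p with hadef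
  set b : Plane → ℝ := fun p => inner ℝ (t₃ p) (N p) / D p with hbdef
  have hSf (p) (hp : p ∈ U) : S p = tangentSpheres f n ρ p := by
    obtain ⟨t, ht⟩ := hS.envelopes p hp
    have : ρ p = t := congrArg Prod.snd ht
    rw [tangentSpheres, this, ht]
  have hSf' (p) (hp : p ∈ U) : f p - ρ p • n p = f' p - ρ p • N p := by
    obtain ⟨t, ht⟩ := hS.envelopes' p hp
    have h1 : ρ p = t := congrArg Prod.snd ht
    have h2 := congrArg Prod.fst ht
    rw [hSf p hp, ← h1] at h2
    exact h2
  have hf' (p) (hp : p ∈ U) : f' p = f p + ρ p • (N p - n p) := by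
    have h := hSf' p hp
    rw [sub_eq_sub_iff_add_eq_add] at h
    rw [smul_sub, ← add_sub_assoc, h, add_sub_cancel_right]
  have sρ : ContDiffOn ℝ ∞ ρ U := hS.spacelike.1.snd
  have sN := hL'.smooth_n
  have hN (p) (hp : p ∈ U) := hL'.inner_n_n hp
  -- Unit vectors with scalar product `1` coincide.
  have D_ne (p) (hp : p ∈ U) : D p ≠ 0 := fun h => hS.distinct p hp <| by
    have h1 : ‖n p‖ = 1 := by
      have := F.n_n p hp
      rw [real_inner_self_eq_norm_sq] at this
      exact (pow_eq_one_iff_of_nonneg (norm_nonneg _) two_ne_zero).mp this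
    exact (inner_eq_one_iff_of_norm_eq_one h1 (hL'.unit p hp)).mp (sub_eq_zero.mp h).symm
  have n_N (p) : inner ℝ (n p) (N p) = 1 - D p := by simp only [hDdef]; ring
  have t₂_N (p) (hp : p ∈ U) : inner ℝ (t₂ p) (N p) = a p * D p :=
    (div_mul_cancel₀ _ (D_ne p hp)).symm
  have t₃_N (p) (hp : p ∈ U) : inner ℝ (t₃ p) (N p) = b p * D p :=
    (div_mul_cancel₀ _ (D_ne p hp)).symm
  have eN (p) (hp : p ∈ U) : N p = n p + D p • (-n p + a p • t₂ p + b p • t₃ p) := by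
    refine eq_of_inner_eq (F.n_n p hp) (F.t₂_t₂ p hp) (F.t₃_t₃ p hp) (F.n_t₂ p hp)
      (F.n_t₃ p hp) (F.t₂_t₃ p hp) ?_ ?_ ?_ <;>
    simp only [inner_add_left, inner_neg_left, real_inner_smul_left, F.n_n p hp,
      F.t₂_t₂ p hp, F.t₃_t₃ p hp, F.n_t₂ p hp, F.n_t₃ p hp, F.t₂_t₃ p hp, F.t₂_n hp, F.t₃_n hp,
      F.t₃_t₂ hp]
    · rw [real_inner_comm, n_N]; ring
    · rw [real_inner_comm, t₂_N p hp]; ring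
    · rw [real_inner_comm, t₃_N p hp]; ring
  -- This is `N · N = 1` in the coordinates of `eN`, divided by `D`.
  have D_mul (p) (hp : p ∈ U) : D p * (1 + a p ^ 2 + b p ^ 2) = 2 := by
    have h := hN p hp
    nth_rewrite 1 [eN p hp] at h
    simp only [inner_add_left, inner_neg_left, real_inner_smul_left, n_N, t₂_N p hp, t₃_N p hp] at h
    exact mul_left_cancel₀ (D_ne p hp) (by linear_combination h)
  have eN' (p) (hp : p ∈ U) : N p = reflectedNormal n t₂ t₃ a b p := by
    have h0 : 1 + a p ^ 2 + b p ^ 2 ≠ 0 := by positivity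
    rw [eN p hp, reflectedNormal, ← D_mul p hp, mul_div_cancel_right₀ _ h0]
  set τ₂ := reflectedTangent t₂ n N a with hτ₂
  set τ₃ := reflectedTangent t₃ n N b with hτ₃
  have N_n (p) : inner ℝ (N p) (n p) = 1 - D p := by rw [real_inner_comm, n_N]
  have N_t₂ (p) (hp : p ∈ U) : inner ℝ (N p) (t₂ p) = a p * D p := by
    rw [real_inner_comm, t₂_N p hp]
  have N_t₃ (p) (hp : p ∈ U) : inner ℝ (N p) (t₃ p) = b p * D p := by
    rw [real_inner_comm, t₃_N p hp]
  have ho (p) (hp : p ∈ U) : inner ℝ (N p) (τ₂ p) = (0 : ℝ) ∧ inner ℝ (N p) (τ₃ p) = (0 : ℝ) ∧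
      inner ℝ (τ₂ p) (τ₂ p) = (1 : ℝ) ∧ inner ℝ (τ₃ p) (τ₃ p) = (1 : ℝ) ∧
      inner ℝ (τ₂ p) (τ₃ p) = (0 : ℝ) := by
    refine ⟨?_, ?_, ?_, ?_, ?_⟩ <;>
    · simp only [hτ₂, hτ₃, reflectedTangent, inner_sub_left, inner_sub_right, real_inner_smul_left,
        real_inner_smul_right, F.n_n p hp, F.t₂_t₂ p hp, F.t₃_t₃ p hp, F.n_t₂ p hp, F.n_t₃ p hp,
        F.t₂_t₃ p hp, F.t₂_n hp, F.t₃_n hp, n_N, t₂_N p hp, t₃_N p hp, hN p hp, N_n,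
        N_t₂ p hp, N_t₃ p hp]
      ring
  -- The Legendre condition `df' · N = 0` for `f' = f + ρ (N - n)` determines `dρ`; substituting it
  -- back leaves `f'_x, f'_y` in terms of the reflected frame and `dN`.
  have hρ (p) (hp : p ∈ U) : HasPartials ρ (-(h₁ p - ρ p * Real.exp (u p)) * a p)
      (-(h₂ p - ρ p * Real.exp (u p)) * b p) p ∧
      ddx f' p = (h₁ p - ρ p * Real.exp (u p)) • τ₂ p + ρ p • ddx N p ∧
      ddy f' p = (h₂ p - ρ p * Real.exp (u p)) • τ₃ p + ρ p • ddy N p := by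
    have dρ := hasPartials_of_contDiffOn hU sρ hp
    have dN := hL'.hasPartials_n hU hp
    obtain ⟨e₁, e₂⟩ := (hL'.hasPartials_f hU hp).unique
      (((F.df p hp).add (dρ.smul (dN.sub (F.dn p hp)))).congr_of_eqOn hU hp hf')
    have k₁ := hL'.inner_ddx_f_n hp
    have k₂ := hL'.inner_ddy_f_n hp
    have l₁ : inner ℝ (ddx N p) (N p) = (0 : ℝ) := by
      rw [real_inner_comm, hL'.inner_ddx_n hU hp]
    have l₂ : inner ℝ (ddy N p) (N p) = (0 : ℝ) := by
      rw [real_inner_comm, hL'.inner_ddy_n hU hp]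
    rw [e₁] at k₁
    rw [e₂] at k₂
    simp only [inner_add_left, inner_sub_left, real_inner_smul_left, l₁, l₂, hN p hp, n_N,
      t₂_N p hp, t₃_N p hp] at k₁ k₂
    have m₁ : ddx ρ p = -(h₁ p - ρ p * Real.exp (u p)) * a p :=
      mul_left_cancel₀ (D_ne p hp) (by linear_combination k₁)
    have m₂ : ddy ρ p = -(h₂ p - ρ p * Real.exp (u p)) * b p :=
      mul_left_cancel₀ (D_ne p hp) (by linear_combination k₂)
    refine ⟨dρ.congr_partials m₁ m₂, ?_, ?_⟩
    · rw [e₁, m₁]; simp only [hτ₂, reflectedTangent]; module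
    · rw [e₂, m₂]; simp only [hτ₃, reflectedTangent]; module
  have dS (p) (hp : p ∈ U) := (F.hasPartials_tangentSpheres hp (hρ p hp).1).congr_of_eqOn hU hp hSf
  have ne₁ (p) (hp : p ∈ U) : h₁ p - ρ p * Real.exp (u p) ≠ 0 := fun h => by
    have := hS.spacelike.2 p hp (1, 0) (by simp)
    rw [(dS p hp).fderiv_apply, h] at this
    simp [lorentz] at this
  have ne₂ (p) (hp : p ∈ U) : h₂ p - ρ p * Real.exp (u p) ≠ 0 := fun h => by
    have := hS.spacelike.2 p hp (0, 1) (by simp)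
    rw [(dS p hp).fderiv_apply, h] at this
    simp [lorentz] at this
  set κ₁ : Plane → ℝ := fun p => inner ℝ (ddx N p) (τ₂ p) with hκ₁
  set κ₂ : Plane → ℝ := fun p => inner ℝ (ddy N p) (τ₃ p) with hκ₂
  have eNx (p) (hp : p ∈ U) : ddx N p = κ₁ p • τ₂ p := by
    obtain ⟨o₁, o₂, o₃, o₄, o₅⟩ := ho p hp
    -- `f'_y · N_x = 0` and `N_y · N_x = 0`, so only `(h₂ - ρ e^u) τ₃ · N_x` remains, and the factor
    -- is nonzero because the congruence is space-like.
    have h : inner ℝ (ddx N p) (τ₃ p) = (0 : ℝ) := by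
      have e := hL'.inner_ddy_f_ddx_n hU hp
      rw [(hρ p hp).2.2, inner_add_left, real_inner_smul_left, real_inner_smul_left,
        real_inner_comm (ddx N p) (ddy N p), hL'.inner_ddx_n_ddy_n hp, mul_zero, add_zero] at e
      rw [real_inner_comm]
      exact (mul_eq_zero.mp e).resolve_left (ne₂ p hp)
    refine eq_of_inner_eq (hN p hp) o₃ o₄ o₁ o₂ o₅ ?_ ?_ ?_
    · rw [real_inner_comm, hL'.inner_ddx_n hU hp, real_inner_smul_left, real_inner_comm, o₁,
        mul_zero]
    · rw [real_inner_smul_left, o₃, mul_one]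
    · rw [real_inner_smul_left, o₅, mul_zero, h]
  have eNy (p) (hp : p ∈ U) : ddy N p = κ₂ p • τ₃ p := by
    obtain ⟨o₁, o₂, o₃, o₄, o₅⟩ := ho p hp
    have h : inner ℝ (ddy N p) (τ₂ p) = (0 : ℝ) := by
      have e := hL'.inner_ddx_f_ddy_n hp
      rw [(hρ p hp).2.1, inner_add_left, real_inner_smul_left, real_inner_smul_left,
        hL'.inner_ddx_n_ddy_n hp, mul_zero, add_zero] at e
      rw [real_inner_comm]
      exact (mul_eq_zero.mp e).resolve_left (ne₁ p hp)
    refine eq_of_inner_eq (hN p hp) o₃ o₄ o₁ o₂ o₅ ?_ ?_ ?_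
    · rw [real_inner_comm, hL'.inner_ddy_n hU hp, real_inner_smul_left, real_inner_comm, o₂,
        mul_zero]
    · rw [real_inner_smul_left, real_inner_comm (τ₂ p) (τ₃ p), o₅, mul_zero, h]
    · rw [real_inner_smul_left, o₄, mul_one]
  have κ₁_sq (p) (hp : p ∈ U) : inner ℝ (ddx N p) (ddx N p) = κ₁ p ^ 2 := by
    rw [eNx p hp, real_inner_smul_left, real_inner_smul_right, (ho p hp).2.2.1]; ring
  have κ₂_sq (p) (hp : p ∈ U) : inner ℝ (ddy N p) (ddy N p) = κ₂ p ^ 2 := by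
    rw [eNy p hp, real_inner_smul_left, real_inner_smul_right, (ho p hp).2.2.2.1]; ring
  have κ_sq (p) (hp : p ∈ U) : κ₁ p ^ 2 = κ₂ p ^ 2 := by
    rw [← κ₁_sq p hp, ← κ₂_sq p hp, hL'.inner_ddy_n_self hp]
  have κ₂_ne (p) (hp : p ∈ U) : κ₂ p ≠ 0 := fun h => by
    have := hL'.inner_ddy_n_pos hp
    rw [κ₂_sq p hp, h] at this
    simp at this
  have sD : ContDiffOn ℝ ∞ D U := contDiffOn_const.sub (F.smooth_n.inner ℝ sN)
  have sa : ContDiffOn ℝ ∞ a U := (F.smooth_t₂.inner ℝ sN).div sD D_ne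
  have sb : ContDiffOn ℝ ∞ b U := (F.smooth_t₃.inner ℝ sN).div sD D_ne
  have sκ₁ : ContDiffOn ℝ ∞ κ₁ U := (contDiffOn_ddx hU sN).inner ℝ
    (F.smooth_t₂.sub (sa.smul (sN.sub F.smooth_n)))
  have sκ₂ : ContDiffOn ℝ ∞ κ₂ U := (contDiffOn_ddy hU sN).inner ℝ
    (F.smooth_t₃.sub (sb.smul (sN.sub F.smooth_n)))
  have G : ReflectedFrame U n t₂ t₃ N D a b κ₁ κ₂ :=
    ⟨sκ₁, sκ₂, D_ne, hN, fun p _ => n_N p, t₂_N, t₃_N, D_mul,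
      fun p hp => (hL'.hasPartials_n hU hp).congr_partials (eNx p hp) (eNy p hp), κ_sq, κ₂_ne⟩
  -- Connectedness of `U` fixes the sign: `κ₁ = κ₂` is the excluded degenerate case and `κ₁ = -κ₂`
  -- is the Riccati case.
  rcases hUc.isPreconnected.eq_or_eq_neg_of_sq_eq sκ₁.continuousOn sκ₂.continuousOn κ_sq
    (fun {p} hp => κ₂_ne p hp) with h | h
  · obtain ⟨C, k, hC, hk⟩ := G.inFixedSphereComplex F hU hUc h fun p hp => (hρ p hp).1
    exact absurd ⟨C, k, hC, fun p hp => by rw [hSf p hp, hk p hp]⟩ hnd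
  · obtain ⟨m, R⟩ := G.exists_riccatiSolution F hU hUc h sN sρ (fun p hp => (hρ p hp).1) ne₁ ne₂
    exact ⟨m, a, b, R, fun p hp => by rw [← eN' p hp, hf' p hp]⟩

end PrincipalFrame

/-! ### The linear system and the Riccati system -/

section LinearSystem

variable {U : Set Plane} {f : Plane → E3} {m : ℝ} {r v₁ v₂ v₃ v₄ : Plane → ℝ}

theorem hasPartials_of_fderiv_eq {g : Plane → ℝ} {L : Plane →L[ℝ] ℝ} {p : Plane} (hU : IsOpen U)
    (hg : ContDiffOn ℝ ∞ g U) (hp : p ∈ U) (h : fderiv ℝ g p = L) :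
    HasPartials g (L (1, 0)) (L (0, 1)) p :=
  (hasPartials_of_contDiffOn hU hg hp).congr_partials (by rw [ddx, h]) (by rw [ddy, h])

theorem sphereMap_eq (f : Plane → E3) (r v₄ : Plane → ℝ) :
    sphereMap f r v₄ = tangentSpheres f (unitNormal f) (fun p => -(r p / (√2 * v₄ p))) := by
  funext p
  refine Prod.ext ?_ rfl
  simp only [sphereMap, tangentSpheres]
  module

/-- The light cone relation turns `1 + a² + b²` into `(v¹ + v⁴) / v⁴`, which is where the
denominators of the explicit formula come from. -/
theorem explicitTransform_eq (f : Plane → E3) {p : Plane}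
    (hn : -2 * v₁ p * v₄ p + v₂ p ^ 2 + v₃ p ^ 2 = 0) (h₁₄ : 0 < v₁ p + v₄ p) (h₄ : v₄ p ≠ 0) :
    explicitTransform f r v₁ v₂ v₃ v₄ p = f p + (-(r p / (√2 * v₄ p))) •
      (reflectedNormal (unitNormal f) (frame₂ f) (frame₃ f) (fun p => v₂ p / (√2 * v₄ p))
        (fun p => v₃ p / (√2 * v₄ p)) p - unitNormal f p) := by
  have hs : √2 ^ 2 = (2 : ℝ) := Real.sq_sqrt (by norm_num)
  have hs0 : √2 ≠ 0 := by positivity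
  have e : 1 + (v₂ p / (√2 * v₄ p)) ^ 2 + (v₃ p / (√2 * v₄ p)) ^ 2 = (v₁ p + v₄ p) / v₄ p := by
    rw [div_pow, div_pow, mul_pow, hs]
    field_simp
    linear_combination hn
  rw [reflectedNormal, e, explicitTransform]
  have h0 := h₁₄.ne'
  match_scalars
  · ring
  · field_simp
    linear_combination r p * v₄ p * hs
  · field_simp
    linear_combination -r p * v₂ p * hs
  · field_simp
    linear_combination -r p * v₃ p * hs

/-- The affine chart of the light cone linearizes the Riccati system. -/
theorem IsTransforming.riccatiSolution (T : IsTransforming U f m r v₁ v₂ v₃ v₄)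
    (F : PrincipalFrame U f (unitNormal f) (frame₂ f) (frame₃ f) (confFactor f) (h₁ f) (h₂ f))
    (hU : IsOpen U) (hi : SphereMapImmersed U f r v₄) :
    RiccatiSolution U (confFactor f) (h₁ f) (h₂ f) m (fun p => v₂ p / (√2 * v₄ p))
      (fun p => v₃ p / (√2 * v₄ p)) (fun p => -(r p / (√2 * v₄ p))) := by
  have hs : √2 * √2 = (2 : ℝ) := Real.mul_self_sqrt (by norm_num)
  have hs0 : √2 ≠ 0 := by positivity
  have s₄ : ContDiffOn ℝ ∞ (fun p => √2 * v₄ p) U := contDiffOn_const.mul T.smooth₄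
  have ne₄ (p) (hp : p ∈ U) : √2 * v₄ p ≠ 0 := mul_ne_zero hs0 (T.v₄_ne p hp)
  have dρ (p) (hp : p ∈ U) : HasPartials (fun p => -(r p / (√2 * v₄ p)))
      (-(h₁ f p - -(r p / (√2 * v₄ p)) * Real.exp (confFactor f p)) * (v₂ p / (√2 * v₄ p)))
      (-(h₂ f p - -(r p / (√2 * v₄ p)) * Real.exp (confFactor f p)) * (v₃ p / (√2 * v₄ p))) p := by
    have d₄ := hasPartials_of_fderiv_eq hU T.smooth₄ hp (T.eq₄ p hp)
    have dr := hasPartials_of_fderiv_eq hU T.smooth_r hp (T.eq_r p hp)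
    have h₄ := T.v₄_ne p hp
    refine (dr.div ((HasPartials.const √2).mul d₄) (ne₄ p hp)).neg.congr_partials ?_ ?_ <;>
    · simp [dX, dY]
      generalize √2 = s at *
      field_simp
      grind
  have dS (p) (hp : p ∈ U) := F.hasPartials_tangentSpheres hp
    (ρ := fun p => -(r p / (√2 * v₄ p))) (a := fun p => v₂ p / (√2 * v₄ p))
    (b := fun p => v₃ p / (√2 * v₄ p)) (dρ p hp)
  refine ⟨T.m_ne, T.smooth₂.div s₄ ne₄, T.smooth₃.div s₄ ne₄, (T.smooth_r.div s₄ ne₄).neg,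
    fun p hp => ?_, fun p hp => ?_, dρ, fun p hp h => ?_, fun p hp h => ?_⟩
  · have d₂ := hasPartials_of_fderiv_eq hU T.smooth₂ hp (T.eq₂ p hp)
    have d₄ := hasPartials_of_fderiv_eq hU T.smooth₄ hp (T.eq₄ p hp)
    have h₄ := T.v₄_ne p hp
    -- The light cone relation eliminates `v¹`; this produces the quadratic terms of the Riccati
    -- system.
    have hn : v₁ p = (v₂ p ^ 2 + v₃ p ^ 2) / (2 * v₄ p) := by
      field_simp
      linear_combination -T.null p hp
    have hE := (Real.exp_pos (confFactor f p)).ne'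
    refine (d₂.div ((HasPartials.const √2).mul d₄) (ne₄ p hp)).congr_partials ?_ ?_ <;>
    · simp [dX, dY, Real.exp_neg, hn]
      generalize √2 = s at *
      field_simp
      try grind
  · have d₃ := hasPartials_of_fderiv_eq hU T.smooth₃ hp (T.eq₃ p hp)
    have d₄ := hasPartials_of_fderiv_eq hU T.smooth₄ hp (T.eq₄ p hp)
    have h₄ := T.v₄_ne p hp
    have hn : v₁ p = (v₂ p ^ 2 + v₃ p ^ 2) / (2 * v₄ p) := by
      field_simp
      linear_combination -T.null p hp
    have hE := (Real.exp_pos (confFactor f p)).ne'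
    refine (d₃.div ((HasPartials.const √2).mul d₄) (ne₄ p hp)).congr_partials ?_ ?_ <;>
    · simp [dX, dY, Real.exp_neg, hn]
      generalize √2 = s at *
      field_simp
      try grind
  -- If the factor vanished, the differential of the sphere map would kill the coordinate direction.
  · have := hi p hp (a₁ := (1, 0)) (a₂ := 0)
      (by rw [sphereMap_eq, (dS p hp).fderiv_apply, (dS p hp).fderiv_apply, h]; simp)
    simp at this
  · have := hi p hp (a₁ := (0, 1)) (a₂ := 0)
      (by rw [sphereMap_eq, (dS p hp).fderiv_apply, (dS p hp).fderiv_apply, h]; simp)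
    simp at this

/-- On a simply connected open set, solutions of the Riccati system lift to the linear system. -/
theorem RiccatiSolution.exists_isTransforming {a b ρ : Plane → ℝ}
    (R : RiccatiSolution U (confFactor f) (h₁ f) (h₂ f) m a b ρ)
    (F : PrincipalFrame U f (unitNormal f) (frame₂ f) (frame₃ f) (confFactor f) (h₁ f) (h₂ f))
    (hU : IsOpen U) (hUs : IsSimplyConnected U) :
    ∃ r v₁ v₂ v₃ v₄ : Plane → ℝ, IsTransforming U f m r v₁ v₂ v₃ v₄ ∧
      (∀ p, a p = v₂ p / (√2 * v₄ p)) ∧ (∀ p, b p = v₃ p / (√2 * v₄ p)) ∧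
      ∀ p, ρ p = -(r p / (√2 * v₄ p)) := by
  have hs : √2 * √2 = (2 : ℝ) := Real.mul_self_sqrt (by norm_num)
  have hs0 : √2 ≠ 0 := by positivity
  have dE (p) (hp : p ∈ U) := (F.hasPartials_u hU hp).exp
  -- A primitive of `e^u (a dx + b dy)`. Closedness follows from the mixed equations for `a_y` and
  -- `b_x`.
  obtain ⟨g, hg⟩ := exists_hasPartials hU hUs
    (fun p hp => (dE p hp).mul (R.da p hp)) (fun p hp => (dE p hp).mul (R.db p hp))
    fun p hp => by ring
  have sg : ContDiffOn ℝ ∞ g U := by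
    have sE := F.smooth_u.exp
    rw [contDiffOn_infty_iff_fderiv_of_isOpen hU]
    refine ⟨fun p hp => (HasFDerivAt.differentiableAt (hg p hp)).differentiableWithinAt, ?_⟩
    have h : ContDiffOn ℝ ∞ (fun p => (Real.exp (confFactor f p) * a p) • dX
        + (Real.exp (confFactor f p) * b p) • dY) U :=
      ((sE.mul R.smooth_a).smul contDiffOn_const).add ((sE.mul R.smooth_b).smul contDiffOn_const)
    refine h.congr fun p hp => ?_
    rw [(hg p hp).fderiv_eq]
    ext <;> simp [dX, dY]
  -- `w = exp (-g)` will be `v⁴`: its equation in the linear system is `dv⁴ = -v⁴ e^u (a dx + b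
  -- dy)`. It is positive also off `U`, so the chart identities hold at every point of the plane and
  -- can be used as equalities of functions.
  obtain ⟨w, w_pos, sw, dw⟩ : ∃ w : Plane → ℝ, (∀ p, 0 < w p) ∧ ContDiffOn ℝ ∞ w U ∧
      ∀ p ∈ U, HasPartials w (w p * -(Real.exp (confFactor f p) * a p))
        (w p * -(Real.exp (confFactor f p) * b p)) p :=
    ⟨fun p => Real.exp (-g p), fun p => Real.exp_pos _, sg.neg.exp, fun p hp => (hg p hp).neg.exp⟩
  have fd {k : Plane → ℝ} {c d : ℝ} {p : Plane} (h : HasPartials k c d p) {L : Plane →L[ℝ] ℝ}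
      (hc : c = L (1, 0)) (hd : d = L (0, 1)) : fderiv ℝ k p = L := by
    rw [h.fderiv_eq, clm_eq_smulRight L, hc, hd]
  -- The chart is inverted with `v⁴ = w`, and `v¹ = (a² + b²) w` is forced by the light cone
  -- relation.
  refine ⟨fun p => -(√2 * ρ p * w p), fun p => (a p * a p + b p * b p) * w p,
    fun p => √2 * a p * w p, fun p => √2 * b p * w p, w, ⟨R.m_ne,
      ((contDiffOn_const.mul R.smooth_ρ).mul sw).neg,
      ((R.smooth_a.mul R.smooth_a).add (R.smooth_b.mul R.smooth_b)).mul sw,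
      (contDiffOn_const.mul R.smooth_a).mul sw, (contDiffOn_const.mul R.smooth_b).mul sw, sw,
      fun p _ => ?_, fun p _ => ?_, fun p _ => (w_pos p).ne', fun p hp => ?_, fun p hp => ?_,
      fun p hp => ?_, fun p hp => ?_, fun p hp => ?_⟩, fun p => ?_, fun p => ?_, fun p => ?_⟩
  · linear_combination w p ^ 2 * (a p ^ 2 + b p ^ 2) * hs
  · have := w_pos p
    have h1 := mul_self_nonneg (a p)
    have h2 := mul_self_nonneg (b p)
    nlinarith
  · have da := R.da p hp
    have db := R.db p hp
    have hE := (Real.exp_pos (confFactor f p)).ne'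
    refine fd (((da.mul da).add (db.mul db)).mul (dw p hp)) ?_ ?_ <;>
    · simp [dX, dY, Real.exp_neg]
      generalize √2 = s at *
      field_simp
      grind
  · have da := R.da p hp
    have hE := (Real.exp_pos (confFactor f p)).ne'
    refine fd (((HasPartials.const √2).mul da).mul (dw p hp)) ?_ ?_ <;>
    · simp [dX, dY, Real.exp_neg]
      generalize √2 = s at *
      field_simp
      grind
  · have db := R.db p hp
    have hE := (Real.exp_pos (confFactor f p)).ne'
    refine fd (((HasPartials.const √2).mul db).mul (dw p hp)) ?_ ?_ <;>
    · simp [dX, dY, Real.exp_neg]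
      generalize √2 = s at *
      field_simp
      grind
  · refine fd (dw p hp) ?_ ?_ <;>
    · simp [dX, dY]
      generalize √2 = s at *
      field_simp
  · have dρ := R.dρ p hp
    refine fd (((HasPartials.const √2).mul dρ).mul (dw p hp)).neg ?_ ?_ <;>
    · simp [dX, dY]
      ring
  all_goals
    have := (w_pos p).ne'
    field_simp

end LinearSystem

end LIsothermic

end

/-! ### The two directions combined. -/

theorem theorem4 (U : Set Plane) (hUo : IsOpen U) (hUc : IsConnected U)
    (f : Plane → E3) (hf : IsLIsothermicImmersion U f) :
    (∀ (m : ℝ) (r v₁ v₂ v₃ v₄ : Plane → ℝ),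
      IsTransforming U f m r v₁ v₂ v₃ v₄ → SphereMapImmersed U f r v₄ →
        IsBianchiDarbouxTransform U f (explicitTransform f r v₁ v₂ v₃ v₄)) ∧
    (∀ f' : Plane → E3, IsBianchiDarbouxTransform U f f' →
      ∀ V : Set Plane, V ⊆ U → IsOpen V → IsSimplyConnected V →
        ∃ (m : ℝ) (r v₁ v₂ v₃ v₄ : Plane → ℝ),
          IsTransforming V f m r v₁ v₂ v₃ v₄ ∧ SphereMapImmersed V f r v₄ ∧
            ∀ p ∈ V, f' p = explicitTransform f r v₁ v₂ v₃ v₄ p) := by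
  have F := hf.principalFrame hUo
  refine ⟨fun m r v₁ v₂ v₃ v₄ T hi => ⟨reflectedNormal (unitNormal f) (frame₂ f) (frame₃ f)
    (fun p => v₂ p / (√2 * v₄ p)) (fun p => v₃ p / (√2 * v₄ p)), ?_⟩, fun f' ⟨N, _, hL', S, hS, hnd⟩ V hVU hV hVs => ?_⟩
  · exact (T.riccatiSolution F hUo hi).isBianchiDarbouxPair F hUo hUc.nonempty hf.legendre
      fun p hp => explicitTransform_eq f (T.null p hp) (T.pos p hp) (T.v₄_ne p hp)
  · obtain ⟨m, a, b, R, hf'⟩ := F.exists_riccatiSolution hUo hUc hL' hS hnd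
    have RV := R.mono hVU
    have FV := F.mono hVU
    obtain ⟨r, v₁, v₂, v₃, v₄, T, ha, hb, hρ⟩ := RV.exists_isTransforming FV hV hVs
    refine ⟨m, r, v₁, v₂, v₃, v₄, T, fun p hp => ?_, fun p hp => ?_⟩
    -- Regularity: a vector in the kernel of the differential would have Lorentz square zero,
    -- against space-likeness.
    · rw [sphereMap_eq, ← funext hρ, injective_iff_map_eq_zero]
      intro X hX
      by_contra h0
      have := (RV.spacelike FV).2 p hp X h0
      rw [hX] at this
      simp [lorentz] at this
    · rw [explicitTransform_eq f (T.null p hp) (T.pos p hp) (T.v₄_ne p hp), ← funext ha,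
        ← funext hb, ← hρ p, hf' p (hVU hp)]
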